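/- Let $F:\mathbb{R}\to\mathbb{R}$ be an even function whose restriction to $]-\infty,0]$ is $C^\infty$ (with one-sided derivatives at $0$) and satisfies $\lim_{t\to-\infty}|t|^mF^{(n)}(t)=0$ for all integers $n,m\ge 0$. Let $\widehat F(x)=\int_{\mathbb{R}}F(u)e^{-ixu}\,du=2\int_0^{+\infty}F(u)\cos(xu)\,du$, let $d_n$ be the number of positive divisors of $n$, and let $\gamma$ be Euler's constant. Then for every $y>0$ $$\sum_{n=1}^{+\infty} d_nF(ny)=\frac1y\int_0^{+\infty}F(u)\Bigl(\ln\frac uy+2\gamma\Bigr)du+\frac{F(0)}4+\frac2y\sum_{n=1}^{+\infty}d_n\int_0^{+\infty}\cos\Bigl(\frac{4\pi^2n}{xy}\Bigr)\widehat F(x)\,\frac{dx}{x},$$ where both series and the first integral on the right converge absolutely, and the integrals in the last series converge as improper integrals at $0$: the integrand is absolutely integrable on $]\varepsilon,+\infty[$ for every $\varepsilon>0$, and $\int_0^{+\infty}=\lim_{\varepsilon\to0^+}\int_\varepsilon^{+\infty}$. -/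

import Mathlib

open Set Filter Topology MeasureTheory
open scoped ContDiff

/-- The space `𝒮(]-∞, a], ℝ)`: `F` is smooth on `]-∞, a]` (one-sided derivatives at `a`), and
`|t|^m F^(n)(t) → 0` as `t → -∞` for all `n` and `m`. Only the values of `F` on `]-∞, a]` matter. -/
structure RapidlyDecreasingOnIic (a : ℝ) (F : ℝ → ℝ) : Prop where
  contDiffOn : ContDiffOn ℝ ∞ F (Iic a)
  tendsto_zero : ∀ n m : ℕ,
    Tendsto (fun t : ℝ => |t| ^ m * iteratedDerivWithin n F (Iic a) t) atBot (𝓝 0)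

/-- The Fourier transform of a real even function, in the normalisation
`F̂(x) = ∫_ℝ F(u) e^{-ixu} du = 2 ∫_0^∞ F(u) cos(xu) du`. -/
noncomputable def fourierHat (F : ℝ → ℝ) (x : ℝ) : ℝ :=
  2 * ∫ u in Ioi (0 : ℝ), F u * Real.cos (x * u)

/-- For an even integrable function, `fourierHat` is the usual Fourier integral. -/
theorem fourierHat_eq_integral_exp {F : ℝ → ℝ} (hF : Function.Even F) (hi : Integrable F)
    (x : ℝ) :
    (fourierHat F x : ℂ) = ∫ u : ℝ, (F u : ℂ) * Complex.exp (-(Complex.I * (x * u))) := by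
  have hc : Integrable (fun u : ℝ => (F u : ℂ) * Complex.exp (-(Complex.I * (x * u)))) := by
    refine hi.ofReal.mul_bdd (c := 1)
      (Continuous.aestronglyMeasurable (by fun_prop)) (ae_of_all _ fun u => ?_)
    rw [Complex.norm_exp]
    simp
  have hsplit := intervalIntegral.integral_Iic_add_Ioi (b := (0 : ℝ)) hc.integrableOn
    hc.integrableOn
  have hneg := integral_comp_neg_Ioi (0 : ℝ)
    (fun u : ℝ => (F u : ℂ) * Complex.exp (-(Complex.I * (x * u))))
  rw [neg_zero] at hneg
  rw [← hsplit, ← hneg, ← integral_add]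
  · rw [fourierHat, Complex.ofReal_mul, ← integral_complex_ofReal, ← integral_const_mul]
    congr 1
    ext u
    rw [hF u]
    push_cast
    rw [Complex.cos]
    ring_nf
  · exact (hc.comp_neg).integrableOn
  · exact hc.integrableOn

/-- `f` has the improper integral `I` over `]0, ∞[`, the limit being taken at the endpoint `0`:
`f` is (absolutely) integrable on `]ε, ∞[` for every `ε > 0`, and `∫_ε^∞ f → I` as `ε → 0⁺`. -/
def HasImproperIntegral (f : ℝ → ℝ) (I : ℝ) : Prop :=
  (∀ ε : ℝ, 0 < ε → IntegrableOn f (Ioi ε)) ∧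
    Tendsto (fun ε : ℝ => ∫ x in Ioi ε, f x) (𝓝[>] 0) (𝓝 I)

/-! Write g = F̂, c = 2π/y, I = ∫_0^∞ F and f_j(v) = g(cj/v)/v. The trapezoid defect Σ_{m≤M} f_j(m)
− f_j(M)/2 − ∫_0^M f_j, summed over j ≥ 1, is computed in two ways as M → ∞.

Cosine side (`tendsto_tsum_trapezoid`): the Fourier series of the Peano kernel of the trapezoid
rule, with two integrations by parts undone, gives the limit 2 Σ_k ∫_0^∞ cos(2πkv) f_j(v) dv for
each j. The substitution x = cj/v turns the integral into ∫ cos(2πkcj/x) g(x) dx/x, which depends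
only on n = jk; summing over (j, k) therefore produces the weights d_n.

Poisson side (`tsum_fourierHat_eq`): Σ_j f_j(v) = y Σ_k F(kvy) + yF(0)/2 − I/v. Summing over v = m
gives y Σ d_n F(ny), and the halved endpoint leaves −yF(0)/4. The integral over [0, M] is evaluated
through Σ_k (1/k) ∫_{kt}^∞ F = ∫_0^∞ F(u) H_{⌊u/t⌋} du. One γ comes from H_{⌊x⌋} − ln x inside this
integral, the other from H_M − ln M.

The analytic difficulty is that F may have a corner at 0, so that g is in general only O(x⁻²).
However, a leading term a/x² of g contributes a multiple of v to f_j, which f_j'' does not see.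
Hence f_j'' is integrable (`IsRapidJet.isInversionRegular`), the (j, k) term is O((jk)⁻²) uniformly
in M, and dominated convergence applies over all pairs. -/

/-- `P n` is the `n`-th derivative on `[0, ∞[` of the smooth rapidly decreasing function `P 0`. -/
structure IsRapidJet (P : ℕ → ℝ → ℝ) : Prop where
  hasDerivWithinAt : ∀ n, ∀ u ∈ Ici (0 : ℝ), HasDerivWithinAt (P n) (P (n + 1) u) (Ici 0) u
  decay : ∀ n m : ℕ, ∃ C, ∀ u : ℝ, 0 ≤ u → u ^ m * |P n u| ≤ C

/-! ### Cosine and sine transforms of rapidly decreasing jets. -/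

/-- Cosine transform on the half line. -/
noncomputable def cosT (p : ℝ → ℝ) (x : ℝ) : ℝ := ∫ u in Ioi (0 : ℝ), p u * Real.cos (x * u)

/-- Sine transform on the half line. -/
noncomputable def sinT (p : ℝ → ℝ) (x : ℝ) : ℝ := ∫ u in Ioi (0 : ℝ), p u * Real.sin (x * u)

/-- The jet of `u ↦ u * P 0 u`. -/
def mulIdJet (P : ℕ → ℝ → ℝ) : ℕ → ℝ → ℝ := fun n u => u * P n u + n * P (n - 1) u

namespace IsRapidJet

variable {P : ℕ → ℝ → ℝ}

theorem shift (h : IsRapidJet P) : IsRapidJet (fun n => P (n + 1)) :=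
  ⟨fun n => h.hasDerivWithinAt (n + 1), fun n => h.decay (n + 1)⟩

theorem mulId (h : IsRapidJet P) : IsRapidJet (mulIdJet P) := by
  refine ⟨fun n u hu => ?_, fun n m => ?_⟩
  · have h1 := ((hasDerivWithinAt_id u (Ici 0)).mul (h.hasDerivWithinAt n u hu))
    rcases n with _ | n
    · refine (h1.congr_of_mem (fun v _ => ?_) hu).congr_deriv ?_
      · simp [mulIdJet]
      · simp [mulIdJet]; ring
    · have h2 := h1.add ((h.hasDerivWithinAt n u hu).const_mul ((n : ℝ) + 1))
      refine (h2.congr_of_mem (fun v _ => ?_) hu).congr_deriv ?_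
      · simp [mulIdJet]
      · simp [mulIdJet]; ring
  · obtain ⟨C₁, h₁⟩ := h.decay n (m + 1)
    -- At n = 0 the truncated index n − 1 = 0 is harmless: its term carries the factor n.
    obtain ⟨C₂, h₂⟩ := h.decay (n - 1) m
    refine ⟨C₁ + n * C₂, fun u hu => ?_⟩
    have hn : (0 : ℝ) ≤ n := by positivity
    calc u ^ m * |mulIdJet P n u| ≤ u ^ m * (|u * P n u| + |n * P (n - 1) u|) := by
          gcongr; exact abs_add_le _ _
      _ = u ^ (m + 1) * |P n u| + n * (u ^ m * |P (n - 1) u|) := by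
          rw [abs_mul, abs_mul, abs_of_nonneg hu, abs_of_nonneg hn]; ring
      _ ≤ _ := by gcongr; exacts [h₁ u hu, h₂ u hu]

theorem continuousOn (h : IsRapidJet P) (n : ℕ) : ContinuousOn (P n) (Ici 0) :=
  fun u hu => (h.hasDerivWithinAt n u hu).continuousWithinAt

theorem hasDerivAt (h : IsRapidJet P) (n : ℕ) {u : ℝ} (hu : 0 < u) :
    HasDerivAt (P n) (P (n + 1) u) u :=
  (h.hasDerivWithinAt n u hu.le).hasDerivAt (Ici_mem_nhds hu)

theorem aestronglyMeasurable (h : IsRapidJet P) (n : ℕ) :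
    AEStronglyMeasurable (P n) (volume.restrict (Ioi 0)) :=
  ((h.continuousOn n).mono Ioi_subset_Ici_self).aestronglyMeasurable measurableSet_Ioi

theorem exists_bound (h : IsRapidJet P) (n : ℕ) :
    ∃ C, 0 ≤ C ∧ ∀ u : ℝ, 0 ≤ u → |P n u| ≤ C * (1 + u ^ 2)⁻¹ := by
  obtain ⟨C₁, h₁⟩ := h.decay n 0
  obtain ⟨C₂, h₂⟩ := h.decay n 2
  have key : ∀ u : ℝ, 0 ≤ u → |P n u| * (1 + u ^ 2) ≤ C₁ + C₂ := fun u hu => by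
    have := h₁ u hu; have := h₂ u hu; simp at *; linarith
  refine ⟨C₁ + C₂, le_trans (by positivity) (key 0 le_rfl), fun u hu => ?_⟩
  rw [← div_eq_mul_inv, le_div_iff₀ (by positivity)]
  exact key u hu

theorem integrableOn (h : IsRapidJet P) (n : ℕ) : IntegrableOn (P n) (Ioi 0) := by
  obtain ⟨C, -, hC⟩ := h.exists_bound n
  refine (integrable_inv_one_add_sq.const_mul C).integrableOn.mono' (h.aestronglyMeasurable n) ?_
  filter_upwards [ae_restrict_mem measurableSet_Ioi] with u hu
  exact hC u (le_of_lt hu)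

theorem integrableOn_mul_cos (h : IsRapidJet P) (n : ℕ) (x : ℝ) :
    IntegrableOn (fun u => P n u * Real.cos (x * u)) (Ioi 0) :=
  (h.integrableOn n).mul_bdd (c := 1) (Continuous.aestronglyMeasurable (by fun_prop))
    (ae_of_all _ fun _ => Real.abs_cos_le_one _)

theorem integrableOn_mul_sin (h : IsRapidJet P) (n : ℕ) (x : ℝ) :
    IntegrableOn (fun u => P n u * Real.sin (x * u)) (Ioi 0) :=
  (h.integrableOn n).mul_bdd (c := 1) (Continuous.aestronglyMeasurable (by fun_prop))
    (ae_of_all _ fun _ => Real.abs_sin_le_one _)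

theorem abs_cosT_le (h : IsRapidJet P) (n : ℕ) (x : ℝ) :
    |cosT (P n) x| ≤ ∫ u in Ioi (0 : ℝ), |P n u| := by
  refine (abs_integral_le_integral_abs).trans
    (integral_mono (h.integrableOn_mul_cos n x).abs (h.integrableOn n).abs fun u => ?_)
  simp only [abs_mul]
  exact mul_le_of_le_one_right (abs_nonneg _) (Real.abs_cos_le_one _)

theorem abs_sinT_le (h : IsRapidJet P) (n : ℕ) (x : ℝ) :
    |sinT (P n) x| ≤ ∫ u in Ioi (0 : ℝ), |P n u| := by
  refine (abs_integral_le_integral_abs).trans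
    (integral_mono (h.integrableOn_mul_sin n x).abs (h.integrableOn n).abs fun u => ?_)
  simp only [abs_mul]
  exact mul_le_of_le_one_right (abs_nonneg _) (Real.abs_sin_le_one _)

theorem tendsto_zero (h : IsRapidJet P) (n : ℕ) : Tendsto (P n) atTop (𝓝 0) := by
  obtain ⟨C, hC⟩ := h.decay n 1
  refine squeeze_zero_norm' ?_
    (tendsto_const_nhds.div_atTop tendsto_id : Tendsto (fun u : ℝ => C / u) atTop (𝓝 0))
  filter_upwards [eventually_gt_atTop 0] with u hu
  rw [le_div_iff₀ hu, mul_comm]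
  simpa using hC u hu.le

/-- Integration by parts. Here sin 0 = 0 removes the boundary term; in `mul_sinT` the value at 0
survives. Alternating the two converts smoothness into decay in x. -/
theorem mul_cosT (h : IsRapidJet P) (n : ℕ) (x : ℝ) :
    x * cosT (P n) x = -sinT (P (n + 1)) x := by
  have hcont : ContinuousWithinAt (fun u => P n u * Real.sin (x * u)) (Ici 0) 0 :=
    (h.continuousOn n 0 self_mem_Ici).mul (Continuous.continuousWithinAt (by fun_prop))
  have hlim : Tendsto (fun u => P n u * Real.sin (x * u)) atTop (𝓝 0) :=
    (h.tendsto_zero n).zero_mul_isBoundedUnder_le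
      (isBoundedUnder_of ⟨1, fun u => Real.abs_sin_le_one _⟩)
  have := integral_Ioi_of_hasDerivAt_of_tendsto
    (f' := fun u => P (n + 1) u * Real.sin (x * u) + x * (P n u * Real.cos (x * u))) hcont
    (fun u hu => ?_)
    ((h.integrableOn_mul_sin (n + 1) x).add ((h.integrableOn_mul_cos n x).const_mul x)) hlim
  · rw [integral_add (h.integrableOn_mul_sin (n + 1) x)
      ((h.integrableOn_mul_cos n x).const_mul x), integral_const_mul] at this
    simp only [mul_zero, Real.sin_zero, sub_zero] at this
    rw [cosT, sinT]; linarith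
  · refine ((h.hasDerivAt n hu).mul (((hasDerivAt_id u).const_mul x).sin)).congr_deriv ?_
    simp; ring

theorem mul_sinT (h : IsRapidJet P) (n : ℕ) (x : ℝ) :
    x * sinT (P n) x = P n 0 + cosT (P (n + 1)) x := by
  have hcont : ContinuousWithinAt (fun u => P n u * Real.cos (x * u)) (Ici 0) 0 :=
    (h.continuousOn n 0 self_mem_Ici).mul (Continuous.continuousWithinAt (by fun_prop))
  have hlim : Tendsto (fun u => P n u * Real.cos (x * u)) atTop (𝓝 0) :=
    (h.tendsto_zero n).zero_mul_isBoundedUnder_le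
      (isBoundedUnder_of ⟨1, fun u => Real.abs_cos_le_one _⟩)
  have := integral_Ioi_of_hasDerivAt_of_tendsto
    (f' := fun u => P (n + 1) u * Real.cos (x * u) - x * (P n u * Real.sin (x * u))) hcont
    (fun u hu => ?_)
    ((h.integrableOn_mul_cos (n + 1) x).sub ((h.integrableOn_mul_sin n x).const_mul x)) hlim
  · rw [integral_sub (h.integrableOn_mul_cos (n + 1) x)
      ((h.integrableOn_mul_sin n x).const_mul x), integral_const_mul] at this
    simp only [mul_zero, Real.cos_zero, mul_one, zero_sub] at this
    rw [cosT, sinT]; linarith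
  · refine ((h.hasDerivAt n hu).mul (((hasDerivAt_id u).const_mul x).cos)).congr_deriv ?_
    simp; ring

theorem hasDerivAt_cosT (h : IsRapidJet P) (x : ℝ) :
    HasDerivAt (cosT (P 0)) (-sinT (mulIdJet P 0) x) x := by
  have hb := (h.mulId.integrableOn 0).abs
  have := (hasDerivAt_integral_of_dominated_loc_of_deriv_le (μ := volume.restrict (Ioi (0 : ℝ)))
    (F := fun x u => P 0 u * Real.cos (x * u))
    (F' := fun x u => -(mulIdJet P 0 u * Real.sin (x * u)))
    (x₀ := x) (s := univ) univ_mem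
    (Eventually.of_forall fun z => (h.integrableOn_mul_cos 0 z).aestronglyMeasurable)
    (h.integrableOn_mul_cos 0 x) (h.mulId.integrableOn_mul_sin 0 x).neg.aestronglyMeasurable
    (bound := fun u => |mulIdJet P 0 u|)
    (ae_of_all _ fun u z _ => by
      rw [norm_neg, Real.norm_eq_abs, abs_mul]
      exact mul_le_of_le_one_right (abs_nonneg _) (Real.abs_sin_le_one _)) hb
    (ae_of_all _ fun u z _ => by
      refine ((((hasDerivAt_id z).mul_const u).cos).const_mul (P 0 u)).congr_deriv ?_
      simp [mulIdJet]; ring)).2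
  rwa [integral_neg] at this

theorem hasDerivAt_sinT (h : IsRapidJet P) (x : ℝ) :
    HasDerivAt (sinT (P 0)) (cosT (mulIdJet P 0) x) x := by
  have hb := (h.mulId.integrableOn 0).abs
  exact (hasDerivAt_integral_of_dominated_loc_of_deriv_le (μ := volume.restrict (Ioi (0 : ℝ)))
    (F := fun x u => P 0 u * Real.sin (x * u))
    (F' := fun x u => mulIdJet P 0 u * Real.cos (x * u))
    (x₀ := x) (s := univ) univ_mem
    (Eventually.of_forall fun z => (h.integrableOn_mul_sin 0 z).aestronglyMeasurable)
    (h.integrableOn_mul_sin 0 x) (h.mulId.integrableOn_mul_cos 0 x).aestronglyMeasurable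
    (bound := fun u => |mulIdJet P 0 u|)
    (ae_of_all _ fun u z _ => by
      rw [Real.norm_eq_abs, abs_mul]
      exact mul_le_of_le_one_right (abs_nonneg _) (Real.abs_cos_le_one _)) hb
    (ae_of_all _ fun u z _ => by
      refine ((((hasDerivAt_id z).mul_const u).sin).const_mul (P 0 u)).congr_deriv ?_
      simp [mulIdJet]; ring)).2

end IsRapidJet

/-! ### Decay of the Fourier transform, adapted to inversion. -/

/-- A twice differentiable function on the real line for which `v ↦ g (1 / v) / v` has a bounded
derivative and an integrable second derivative on `]0, ∞[`. -/
structure IsInversionRegular (g g₁ g₂ : ℝ → ℝ) (K : ℝ) : Prop where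
  hasDerivAt : ∀ x, HasDerivAt g (g₁ x) x
  hasDerivAt₁ : ∀ x, HasDerivAt g₁ (g₂ x) x
  bound : ∀ x, |g x| ≤ K
  bound₁ : ∀ x, |g₁ x| ≤ K
  bound₂ : ∀ x, |g₂ x| ≤ K
  decay : ∀ x, x ^ 2 * |g x| ≤ K
  decay₁ : ∀ x, |x ^ 3 * g₁ x| ≤ K
  decay₂ : ∀ x, |2 * x ^ 3 * g x + 4 * x ^ 4 * g₁ x + x ^ 5 * g₂ x| ≤ K

theorem IsRapidJet.isInversionRegular {P : ℕ → ℝ → ℝ} (h : IsRapidJet P) :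
    ∃ g₁ g₂ K, IsInversionRegular (fun x => 2 * cosT (P 0) x) g₁ g₂ K := by
  have h1 := h.mulId
  have h2 := h1.mulId
  have hq := h.shift.shift.mulId.mulId
  -- Q is the jet of u² P''(u).
  set Q := mulIdJet (mulIdJet fun n => P (n + 1 + 1)) with hQ
  obtain ⟨K, hK⟩ : ∃ K, K = 2 * ((∫ u in Ioi (0 : ℝ), |P 0 u|)
      + (∫ u in Ioi (0 : ℝ), |mulIdJet P 0 u|)
      + (∫ u in Ioi (0 : ℝ), |mulIdJet (mulIdJet P) 0 u|)
      + (|P 1 0| + ∫ u in Ioi (0 : ℝ), |P 2 u|)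
      + (|mulIdJet P 2 0| + ∫ u in Ioi (0 : ℝ), |mulIdJet P 3 u|)
      + (∫ u in Ioi (0 : ℝ), |Q 3 u|)) := ⟨_, rfl⟩
  have n1 : 0 ≤ ∫ u in Ioi (0 : ℝ), |P 0 u| := integral_nonneg fun _ => abs_nonneg _
  have n2 : 0 ≤ ∫ u in Ioi (0 : ℝ), |mulIdJet P 0 u| := integral_nonneg fun _ => abs_nonneg _
  have n3 : 0 ≤ ∫ u in Ioi (0 : ℝ), |mulIdJet (mulIdJet P) 0 u| :=
    integral_nonneg fun _ => abs_nonneg _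
  have n4 : 0 ≤ ∫ u in Ioi (0 : ℝ), |P 2 u| := integral_nonneg fun _ => abs_nonneg _
  have n5 : 0 ≤ ∫ u in Ioi (0 : ℝ), |mulIdJet P 3 u| := integral_nonneg fun _ => abs_nonneg _
  have n6 : 0 ≤ ∫ u in Ioi (0 : ℝ), |Q 3 u| := integral_nonneg fun _ => abs_nonneg _
  have n7 := abs_nonneg (P 1 0)
  have n8 := abs_nonneg (mulIdJet P 2 0)
  refine ⟨fun x => 2 * -sinT (mulIdJet P 0) x, fun x => 2 * -cosT (mulIdJet (mulIdJet P) 0) x, K,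
    fun x => (h.hasDerivAt_cosT x).const_mul 2, fun x => (h1.hasDerivAt_sinT x).neg.const_mul 2,
    fun x => ?_, fun x => ?_, fun x => ?_, fun x => ?_, fun x => ?_, fun x => ?_⟩
  · have := h.abs_cosT_le 0 x
    rw [abs_mul, abs_two]; linarith
  · have := h1.abs_sinT_le 0 x
    rw [abs_mul, abs_two, abs_neg]; linarith
  · have := h2.abs_cosT_le 0 x
    rw [abs_mul, abs_two, abs_neg]; linarith
  · have e : x ^ 2 * (2 * cosT (P 0) x) = 2 * -(P 1 0 + cosT (P 2) x) := by
      have := h.mul_cosT 0 x; have := h.mul_sinT 1 x; grind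
    rw [← abs_of_nonneg (sq_nonneg x), ← abs_mul, e, abs_mul, abs_two, abs_neg]
    have := h.abs_cosT_le 2 x
    have := abs_add_le (P 1 0) (cosT (P 2) x)
    linarith
  · have e : x ^ 3 * (2 * -sinT (mulIdJet P 0) x)
        = 2 * (mulIdJet P 2 0 + cosT (mulIdJet P 3) x) := by
      have a0 : mulIdJet P 0 0 = 0 := by simp [mulIdJet]
      have := h1.mul_sinT 0 x; have := h1.mul_cosT 1 x; have := h1.mul_sinT 2 x
      simp only [zero_add, one_add_one_eq_two, Nat.reduceAdd] at *
      grind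
    rw [e, abs_mul, abs_two]
    have := h1.abs_cosT_le 3 x
    have := abs_add_le (mulIdJet P 2 0) (cosT (mulIdJet P 3) x)
    linarith
  · have e1 : x ^ 2 * cosT (mulIdJet (mulIdJet P) 0) x = -cosT (mulIdJet (mulIdJet P) 2) x := by
      have a0 : mulIdJet (mulIdJet P) 1 0 = 0 := by simp [mulIdJet]
      have := h2.mul_cosT 0 x; have := h2.mul_sinT 1 x
      grind
    have e2 : x * sinT (mulIdJet P 0) x = cosT (mulIdJet P 1) x := by
      have a0 : mulIdJet P 0 0 = 0 := by simp [mulIdJet]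
      have := h1.mul_sinT 0 x
      grind
    -- This is (u²P)'' = u²P'' + 4(uP)' − 2P. In the combination bounded by `decay₂`, the last two
    -- terms cancel exactly against the contributions of g and g₁, so the corner of F at 0
    -- disappears and only 2x³ times the transform of u²P'' remains.
    have e3 : cosT (mulIdJet (mulIdJet P) 2) x
        = cosT (Q 0) x + 4 * cosT (mulIdJet P 1) x - 2 * cosT (P 0) x := by
      simp only [cosT]
      rw [← integral_const_mul, ← integral_const_mul, ← integral_add, ← integral_sub]
      · congr 1
        ext u
        simp [mulIdJet, hQ]; ring
      · exact (hq.integrableOn_mul_cos 0 x).add ((h1.integrableOn_mul_cos 1 x).const_mul 4)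
      · exact (h.integrableOn_mul_cos 0 x).const_mul 2
      · exact hq.integrableOn_mul_cos 0 x
      · exact (h1.integrableOn_mul_cos 1 x).const_mul 4
    -- Three integrations by parts meet a single boundary term, Q 1 0, which vanishes because of the
    -- factor u².
    have e4 : x ^ 3 * cosT (Q 0) x = sinT (Q 3) x := by
      have a0 : Q 1 0 = 0 := by simp [hQ, mulIdJet]
      have := hq.mul_cosT 0 x; have := hq.mul_sinT 1 x; have := hq.mul_cosT 2 x
      simp only [zero_add, one_add_one_eq_two, Nat.reduceAdd] at *
      grind
    have e : 2 * x ^ 3 * (2 * cosT (P 0) x) + 4 * x ^ 4 * (2 * -sinT (mulIdJet P 0) x)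
        + x ^ 5 * (2 * -cosT (mulIdJet (mulIdJet P) 0) x) = 2 * sinT (Q 3) x := by
      grind
    rw [e, abs_mul, abs_two]
    have := hq.abs_sinT_le 3 x
    linarith

/-- Evenness transports the data from the left half line by u ↦ −u, which brings in the sign (−1)ⁿ.
Decay controls a neighbourhood of infinity and compactness the rest. -/
theorem RapidlyDecreasingOnIic.exists_isRapidJet {F : ℝ → ℝ} (hF : RapidlyDecreasingOnIic 0 F)
    (hEven : Function.Even F) : ∃ P, IsRapidJet P ∧ P 0 = F := by
  have hcont : ∀ n, ContinuousOn (iteratedDerivWithin n F (Iic 0)) (Iic 0) := fun n =>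
    hF.contDiffOn.continuousOn_iteratedDerivWithin (by exact_mod_cast le_top) (uniqueDiffOn_Iic 0)
  refine ⟨fun n u => (-1) ^ n * iteratedDerivWithin n F (Iic 0) (-u),
    ⟨fun n u hu => ?_, fun n m => ?_⟩, ?_⟩
  · have hd : HasDerivWithinAt (iteratedDerivWithin n F (Iic 0))
        (iteratedDerivWithin (n + 1) F (Iic 0) (-u)) (Iic 0) (-u) := by
      rw [iteratedDerivWithin_succ]
      refine DifferentiableWithinAt.hasDerivWithinAt ?_
      exact hF.contDiffOn.differentiableOn_iteratedDerivWithin (by exact_mod_cast ENat.natCast_lt_top n)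
        (uniqueDiffOn_Iic 0) (-u) (by simpa using hu)
    have := (hd.comp u (hasDerivWithinAt_neg u (Ici 0))
      (fun v hv => by simpa using hv)).const_mul ((-1) ^ n)
    refine this.congr_deriv ?_
    ring
  · have ht := (hF.tendsto_zero n m).norm
    rw [norm_zero] at ht
    have hev : ∀ᶠ t : ℝ in atBot, ‖|t| ^ m * iteratedDerivWithin n F (Iic 0) t‖ ≤ 1 :=
      (ht.eventually_lt_const one_pos).mono fun _ => le_of_lt
    obtain ⟨A, hA⟩ := eventually_atBot.1 hev
    have hc : ContinuousOn (fun t => |t| ^ m * iteratedDerivWithin n F (Iic 0) t) (Icc A 0) :=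
      (Continuous.continuousOn (by fun_prop)).mul ((hcont n).mono Icc_subset_Iic_self)
    obtain ⟨C, hC⟩ := isCompact_Icc.exists_bound_of_continuousOn hc
    refine ⟨max C 1, fun u hu => ?_⟩
    have e : u ^ m * |(-1) ^ n * iteratedDerivWithin n F (Iic 0) (-u)|
        = ‖|(-u)| ^ m * iteratedDerivWithin n F (Iic 0) (-u)‖ := by
      simp [abs_mul, abs_of_nonneg hu]
    rw [e]
    by_cases h : -u ≤ A
    · exact (hA _ h).trans (le_max_right _ _)
    · exact (hC _ ⟨by linarith, by linarith⟩).trans (le_max_left _ _)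
  · ext u
    simp [hEven u]

/-! ### The trapezoid rule on the half line and its cosine expansion. -/

/-- A function on `[0, ∞[` vanishing at `0` and at infinity, twice differentiable on `]0, ∞[`,
with bounded first derivative vanishing at infinity and integrable second derivative. -/
structure IsTrapezoidRegular (f f₁ f₂ : ℝ → ℝ) : Prop where
  zero : f 0 = 0
  hasDerivAt : ∀ v, 0 < v → HasDerivAt f (f₁ v) v
  hasDerivAt₁ : ∀ v, 0 < v → HasDerivAt f₁ (f₂ v) v
  bound : ∃ K, ∀ v, 0 < v → |f v| ≤ K * v ∧ |f₁ v| ≤ K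
  integrableOn₂ : IntegrableOn f₂ (Ioi 0)
  tendsto_zero : Tendsto f atTop (𝓝 0)
  tendsto_zero₁ : Tendsto f₁ atTop (𝓝 0)

namespace IsTrapezoidRegular

variable {f f₁ f₂ : ℝ → ℝ}

theorem continuousOn (h : IsTrapezoidRegular f f₁ f₂) : ContinuousOn f (Ici 0) := by
  intro v hv
  rcases (show (0 : ℝ) ≤ v from hv).eq_or_lt with rfl | hv
  · obtain ⟨K, hK⟩ := h.bound
    have h0 : Tendsto (fun v : ℝ => K * v) (𝓝[Ici 0] 0) (𝓝 0) := by
      have : Continuous fun v : ℝ => K * v := by fun_prop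
      simpa using (this.tendsto 0).mono_left nhdsWithin_le_nhds
    rw [ContinuousWithinAt, h.zero]
    refine squeeze_zero_norm' ?_ h0
    filter_upwards [self_mem_nhdsWithin] with v hv
    rcases (show (0 : ℝ) ≤ v from hv).eq_or_lt with rfl | hv
    · simp [h.zero]
    · exact (hK v hv).1
  · exact (h.hasDerivAt v hv).continuousAt.continuousWithinAt

/-- Nothing is assumed about `f₁` at 0. A weight vanishing at the left endpoint, times a bounded
derivative, is still continuous there, which is all that integration by parts needs. -/
theorem continuousOn_mul_deriv (h : IsTrapezoidRegular f f₁ f₂) {w : ℝ → ℝ} (hw : Continuous w)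
    {c : ℝ} (hc : 0 ≤ c) (hwc : w c = 0) : ContinuousOn (fun v => w v * f₁ v) (Ici c) := by
  intro v hv
  rcases (show c ≤ v from hv).eq_or_lt with rfl | hv
  · obtain ⟨K, hK⟩ := h.bound
    have h0 : Tendsto (fun v : ℝ => |w v| * K) (𝓝[Ici c] c) (𝓝 0) := by
      have : Continuous fun v : ℝ => |w v| * K := by fun_prop
      simpa [hwc] using (this.tendsto c).mono_left nhdsWithin_le_nhds
    rw [ContinuousWithinAt, hwc, zero_mul]
    refine squeeze_zero_norm' ?_ h0
    filter_upwards [self_mem_nhdsWithin] with v hv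
    rcases (show c ≤ v from hv).eq_or_lt with rfl | hv
    · simp [hwc]
    · rw [Real.norm_eq_abs, abs_mul]
      exact mul_le_mul_of_nonneg_left (hK v (hc.trans_lt hv)).2 (abs_nonneg _)
  · exact (hw.continuousAt.mul (h.hasDerivAt₁ v (hc.trans_lt hv)).continuousAt).continuousWithinAt

theorem intervalIntegrable₂ (h : IsTrapezoidRegular f f₁ f₂) {a b : ℝ} (ha : 0 ≤ a) (hab : a ≤ b) :
    IntervalIntegrable f₂ volume a b := by
  rw [intervalIntegrable_iff_integrableOn_Ioc_of_le hab]
  exact h.integrableOn₂.mono_set fun v hv => ha.trans_lt hv.1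

theorem intervalIntegrable (h : IsTrapezoidRegular f f₁ f₂) {a b : ℝ} (ha : 0 ≤ a) (hab : a ≤ b) :
    IntervalIntegrable f volume a b := by
  refine ContinuousOn.intervalIntegrable (h.continuousOn.mono ?_)
  rw [uIcc_of_le hab]
  exact fun v hv => ha.trans hv.1

theorem integrableOn_one_sub_cos_mul (h : IsTrapezoidRegular f f₁ f₂) (a : ℝ) :
    IntegrableOn (fun v => (1 - Real.cos (a * v)) * f₂ v) (Ioi 0) :=
  h.integrableOn₂.bdd_mul (c := 2) (Continuous.aestronglyMeasurable (by fun_prop))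
    (ae_of_all _ fun v => by
      rw [Real.norm_eq_abs, abs_le]
      constructor <;> linarith [Real.cos_le_one (a * v), Real.neg_one_le_cos (a * v)])

/-- Two integrations by parts. The antiderivative (1 − cos)/a² is normalised to vanish at 0, so that
no value of `f₁` at 0 enters. -/
theorem integral_cos_mul (h : IsTrapezoidRegular f f₁ f₂) {a : ℝ} (ha : 0 < a) {V : ℝ}
    (hV : 0 ≤ V) :
    ∫ v in 0..V, Real.cos (a * v) * f v = Real.sin (a * V) / a * f V
      - (1 - Real.cos (a * V)) / a ^ 2 * f₁ V
      + 1 / a ^ 2 * ∫ v in 0..V, (1 - Real.cos (a * v)) * f₂ v := by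
  have i1 : IntervalIntegrable (fun v => Real.cos (a * v) * f v) volume 0 V :=
    (h.intervalIntegrable le_rfl hV).continuousOn_mul (Continuous.continuousOn (by fun_prop))
  have i2 : IntervalIntegrable (fun v => (1 - Real.cos (a * v)) * f₂ v) volume 0 V :=
    (h.intervalIntegrable₂ le_rfl hV).continuousOn_mul (Continuous.continuousOn (by fun_prop))
  have hc : ContinuousOn (fun v => Real.sin (a * v) / a * f v
      - (1 - Real.cos (a * v)) / a ^ 2 * f₁ v) (Icc 0 V) := by
    refine ((Continuous.continuousOn (by fun_prop)).mul
      (h.continuousOn.mono Icc_subset_Ici_self)).sub ?_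
    exact (h.continuousOn_mul_deriv (w := fun v => (1 - Real.cos (a * v)) / a ^ 2) (by fun_prop)
      le_rfl (by simp)).mono Icc_subset_Ici_self
  have key := intervalIntegral.integral_eq_sub_of_hasDerivAt_of_le hV hc
    (f' := fun v => Real.cos (a * v) * f v - 1 / a ^ 2 * ((1 - Real.cos (a * v)) * f₂ v))
    (fun v hv => ?_) (i1.sub (i2.const_mul _))
  · rw [intervalIntegral.integral_sub i1 (i2.const_mul _),
      intervalIntegral.integral_const_mul] at key
    simp only [mul_zero, Real.sin_zero, Real.cos_zero, sub_self, zero_div, zero_mul] at key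
    linarith
  · have hl : HasDerivAt (fun v => a * v) a v := by simpa using (hasDerivAt_id v).const_mul a
    refine (((hl.sin.div_const a).mul (h.hasDerivAt v hv.1)).sub
      (((hl.cos.const_sub 1).div_const (a ^ 2)).mul (h.hasDerivAt₁ v hv.1))).congr_deriv ?_
    field_simp
    ring

theorem tendsto_integral_one_sub_cos_mul (h : IsTrapezoidRegular f f₁ f₂) (a : ℝ) :
    Tendsto (fun V : ℝ => ∫ v in 0..V, (1 - Real.cos (a * v)) * f₂ v) atTop
      (𝓝 (∫ v in Ioi (0 : ℝ), (1 - Real.cos (a * v)) * f₂ v)) :=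
  intervalIntegral_tendsto_integral_Ioi 0 (h.integrableOn_one_sub_cos_mul a) tendsto_id

theorem tendsto_integral_cos_mul (h : IsTrapezoidRegular f f₁ f₂) {a : ℝ} (ha : 0 < a) :
    Tendsto (fun V : ℝ => ∫ v in 0..V, Real.cos (a * v) * f v) atTop
      (𝓝 (1 / a ^ 2 * ∫ v in Ioi (0 : ℝ), (1 - Real.cos (a * v)) * f₂ v)) := by
  have t1 : Tendsto (fun V => Real.sin (a * V) / a * f V) atTop (𝓝 0) := by
    refine isBoundedUnder_le_mul_tendsto_zero (isBoundedUnder_of ⟨1 / a, fun u => ?_⟩) h.tendsto_zero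
    simp only [Function.comp, Real.norm_eq_abs, abs_div, abs_of_pos ha]
    gcongr
    exact Real.abs_sin_le_one _
  have t2 : Tendsto (fun V => (1 - Real.cos (a * V)) / a ^ 2 * f₁ V) atTop (𝓝 0) := by
    refine isBoundedUnder_le_mul_tendsto_zero (isBoundedUnder_of ⟨2 / a ^ 2, fun u => ?_⟩)
      h.tendsto_zero₁
    simp only [Function.comp, Real.norm_eq_abs, abs_div, abs_of_pos (pow_pos ha 2)]
    gcongr
    rw [abs_le]
    constructor <;> linarith [Real.cos_le_one (a * u), Real.neg_one_le_cos (a * u)]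
  have := (t1.sub t2).add ((h.tendsto_integral_one_sub_cos_mul a).const_mul (1 / a ^ 2))
  rw [sub_zero, zero_add] at this
  refine this.congr' ?_
  filter_upwards [eventually_ge_atTop 0] with V hV
  rw [h.integral_cos_mul ha hV]

theorem abs_integral_one_sub_cos_mul_le (h : IsTrapezoidRegular f f₁ f₂) (a : ℝ) {V : ℝ}
    (hV : 0 ≤ V) :
    |∫ v in 0..V, (1 - Real.cos (a * v)) * f₂ v| ≤ 2 * ∫ v in Ioi (0 : ℝ), |f₂ v| := by
  rw [intervalIntegral.integral_of_le hV, ← integral_const_mul]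
  refine (abs_integral_le_integral_abs).trans ?_
  refine (setIntegral_mono_set (h.integrableOn_one_sub_cos_mul a).abs
    (ae_of_all _ fun v => abs_nonneg _) Ioc_subset_Ioi_self.eventuallyLE).trans ?_
  refine integral_mono (h.integrableOn_one_sub_cos_mul a).abs (h.integrableOn₂.abs.const_mul 2)
    fun v => ?_
  simp only [abs_mul]
  gcongr
  rw [abs_le]
  constructor <;> linarith [Real.cos_le_one (a * v), Real.neg_one_le_cos (a * v)]

end IsTrapezoidRegular

/-- The Fourier series of the Bernoulli polynomial B₂, used through B₂(0) − B₂(t) = t − t². -/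
theorem hasSum_one_sub_cos_div_sq {t : ℝ} (ht : t ∈ Icc (0 : ℝ) 1) :
    HasSum (fun k : ℕ+ => 2 / (2 * Real.pi * k) ^ 2 * (1 - Real.cos (2 * Real.pi * k * t)))
      ((t - t ^ 2) / 2) := by
  have hB : ∀ x : ℝ, (Polynomial.map (algebraMap ℚ ℝ) (Polynomial.bernoulli (2 * 1))).eval x
      = x ^ 2 - x + 1 / 6 := fun x => by
    simp [Polynomial.bernoulli, Finset.sum_range_succ, Polynomial.eval_monomial]
    ring
  have h0 := hasSum_one_div_nat_pow_mul_cos one_ne_zero (left_mem_Icc.2 zero_le_one)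
  have h1 := hasSum_one_div_nat_pow_mul_cos one_ne_zero ht
  rw [hB] at h0 h1
  have h2 := (h0.sub h1).mul_left (1 / (2 * Real.pi ^ 2))
  have h3 := (Function.Injective.hasSum_iff PNat.coe_injective (fun n hn => by
    have : n = 0 := by
      by_contra h
      exact hn ⟨⟨n, Nat.pos_of_ne_zero h⟩, rfl⟩
    simp [this])).2 h2
  have hpi := Real.pi_pos.ne'
  have e : (1 / (2 * Real.pi ^ 2) * ((-1 : ℝ) ^ (1 + 1) * (2 * Real.pi) ^ (2 * 1) / 2
      / (2 * 1).factorial * (0 ^ 2 - 0 + 1 / 6) - (-1 : ℝ) ^ (1 + 1) * (2 * Real.pi) ^ (2 * 1) / 2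
      / (2 * 1).factorial * (t ^ 2 - t + 1 / 6))) = (t - t ^ 2) / 2 := by
    norm_num [Nat.factorial]
    field_simp
    ring
  rw [e] at h3
  refine h3.congr_fun fun k => ?_
  have : (k : ℝ) ≠ 0 := by exact_mod_cast k.pos.ne'
  simp only [Function.comp, mul_zero, Real.cos_zero]
  field_simp
  ring

theorem summable_pnat_inv_sq : Summable fun k : ℕ+ => 1 / (k : ℝ) ^ 2 :=
  (Real.summable_one_div_nat_pow.2 one_lt_two).comp_injective PNat.coe_injective

namespace IsTrapezoidRegular

variable {f f₁ f₂ : ℝ → ℝ}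

/-- The trapezoid error on [m, m + 1] is the integral of f'' against the Peano kernel (s − s²)/2, s
= v − m. The cosine series of the kernel is then integrated termwise. -/
theorem hasSum_integral_unit (h : IsTrapezoidRegular f f₁ f₂) (m : ℕ) :
    HasSum (fun k : ℕ+ => 2 / (2 * Real.pi * k) ^ 2 *
        ∫ v in (m : ℝ)..(m + 1 : ℕ), (1 - Real.cos (2 * Real.pi * k * v)) * f₂ v)
      ((f m + f (m + 1)) / 2 - ∫ v in (m : ℝ)..(m + 1 : ℕ), f v) := by
  have hm : (0 : ℝ) ≤ m := m.cast_nonneg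
  have hle : (m : ℝ) ≤ (m + 1 : ℕ) := by push_cast; linarith
  have i1 := h.intervalIntegrable hm hle
  have i2 := h.intervalIntegrable₂ hm hle
  have i3 : IntervalIntegrable (fun v => (v - m - (v - m) ^ 2) / 2 * f₂ v) volume m (m + 1 : ℕ) :=
    i2.continuousOn_mul (Continuous.continuousOn (by fun_prop))
  have hparts : ∫ v in (m : ℝ)..(m + 1 : ℕ), (v - m - (v - m) ^ 2) / 2 * f₂ v
      = (f m + f (m + 1)) / 2 - ∫ v in (m : ℝ)..(m + 1 : ℕ), f v := by
    have hc : ContinuousOn (fun v => (v - m - (v - m) ^ 2) / 2 * f₁ v + (v - m - 1 / 2) * f v)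
        (Icc (m : ℝ) (m + 1 : ℕ)) := by
      refine ((h.continuousOn_mul_deriv (w := fun v => (v - m - (v - m) ^ 2) / 2) (by fun_prop)
        hm (by simp)).mono Icc_subset_Ici_self).add ((Continuous.continuousOn (by fun_prop)).mul
        (h.continuousOn.mono fun v hv => hm.trans hv.1))
    have key := intervalIntegral.integral_eq_sub_of_hasDerivAt_of_le hle hc
      (f' := fun v => (v - m - (v - m) ^ 2) / 2 * f₂ v + f v) (fun v hv => ?_) (i3.add i1)
    · rw [intervalIntegral.integral_add i3 i1] at key
      rw [eq_sub_iff_add_eq, key]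
      push_cast
      ring
    · have hv0 : 0 < v := hm.trans_lt hv.1
      have hl : HasDerivAt (fun v : ℝ => v - m) 1 v := (hasDerivAt_id v).sub_const _
      refine ((((hl.sub (hl.pow 2)).div_const 2).mul (h.hasDerivAt₁ v hv0)).add
        ((hl.sub_const (1 / 2)).mul (h.hasDerivAt v hv0))).congr_deriv ?_
      simp
      ring
  rw [← hparts]
  have key := intervalIntegral.hasSum_integral_of_dominated_convergence (μ := volume)
    (a := m) (b := (m + 1 : ℕ)) (ι := ℕ+)
    (F := fun k v => 2 / (2 * Real.pi * k) ^ 2 * ((1 - Real.cos (2 * Real.pi * k * v)) * f₂ v))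
    (f := fun v => (v - m - (v - m) ^ 2) / 2 * f₂ v)
    (fun k v => 1 / (k : ℝ) ^ 2 * |f₂ v|) (fun k => ?_) (fun k => ae_of_all _ fun v _ => ?_)
    (ae_of_all _ fun v _ => summable_pnat_inv_sq.mul_right _) ?_ (ae_of_all _ fun v hv => ?_)
  · simpa only [intervalIntegral.integral_const_mul] using key
  · have := i2.def'.aestronglyMeasurable
    exact ((Continuous.aestronglyMeasurable (by fun_prop)).mul this).const_mul _
  · rw [norm_mul, norm_mul]
    have hk : (0 : ℝ) < k := by exact_mod_cast k.pos
    have e1 : ‖1 - Real.cos (2 * Real.pi * k * v)‖ ≤ 2 := by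
      rw [Real.norm_eq_abs, abs_le]
      constructor <;> linarith [Real.cos_le_one (2 * Real.pi * k * v),
        Real.neg_one_le_cos (2 * Real.pi * k * v)]
    have e2 : ‖2 / (2 * Real.pi * k) ^ 2‖ ≤ 1 / 2 * (1 / (k : ℝ) ^ 2) := by
      rw [Real.norm_of_nonneg (by positivity), div_mul_div_comm, div_le_div_iff₀ (by positivity)
        (by positivity)]
      have : 9 * (k : ℝ) ^ 2 ≤ Real.pi ^ 2 * k ^ 2 := by
        gcongr
        nlinarith [Real.pi_gt_three]
      nlinarith [sq_nonneg (k : ℝ)]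
    calc _ ≤ 1 / 2 * (1 / (k : ℝ) ^ 2) * (2 * |f₂ v|) := by gcongr; exact le_rfl
      _ = _ := by ring
  · simp only [tsum_mul_right]
    exact i2.abs.const_mul _
  · rw [uIoc_of_le hle] at hv
    have hm1 : ((m + 1 : ℕ) : ℝ) = m + 1 := by push_cast; rfl
    have := (hasSum_one_sub_cos_div_sq (t := v - m)
      ⟨by linarith [hv.1], by linarith [hv.2, hm1]⟩).mul_right (f₂ v)
    refine this.congr_fun fun k => ?_
    -- Periodicity makes the kernel independent of m, so the unit intervals can be glued together.
    have : 2 * Real.pi * k * (v - m) = 2 * Real.pi * k * v - (k * m : ℕ) * (2 * Real.pi) := by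
      push_cast; ring
    rw [this, Real.cos_sub_nat_mul_two_pi]
    ring

/-- Gluing of the unit intervals. Since f(0) = 0, only the endpoint M keeps weight 1/2. -/
theorem hasSum_integral (h : IsTrapezoidRegular f f₁ f₂) (M : ℕ) :
    HasSum (fun k : ℕ+ => 2 / (2 * Real.pi * k) ^ 2 *
        ∫ v in (0 : ℝ)..M, (1 - Real.cos (2 * Real.pi * k * v)) * f₂ v)
      (∑ m ∈ Finset.range M, f (m + 1 : ℕ) - f M / 2 - ∫ v in (0 : ℝ)..M, f v) := by
  have h1 := hasSum_sum (s := Finset.range M) fun m _ => h.hasSum_integral_unit m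
  have e1 : ∑ m ∈ Finset.range M, ((f m + f (m + 1)) / 2 - ∫ v in (m : ℝ)..(m + 1 : ℕ), f v)
      = ∑ m ∈ Finset.range M, f (m + 1 : ℕ) - f M / 2 - ∫ v in (0 : ℝ)..M, f v := by
    rw [Finset.sum_sub_distrib, intervalIntegral.sum_integral_adjacent_intervals
      (a := fun m : ℕ => (m : ℝ)) fun m _ => h.intervalIntegrable m.cast_nonneg (by simp)]
    rw [Nat.cast_zero]
    congr 1
    have : ∑ m ∈ Finset.range M, (f (m + 1 : ℕ) - f (m : ℕ)) = f M - f (0 : ℕ) :=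
      Finset.sum_range_sub (fun m : ℕ => f m) M
    rw [Nat.cast_zero, h.zero, sub_zero, Finset.sum_sub_distrib] at this
    rw [← Finset.sum_div, Finset.sum_add_distrib]
    push_cast at this ⊢
    linarith
  rw [e1] at h1
  refine h1.congr_fun fun k => ?_
  rw [← Finset.mul_sum, intervalIntegral.sum_integral_adjacent_intervals
    (a := fun m : ℕ => (m : ℝ)) fun m _ => (h.intervalIntegrable₂ m.cast_nonneg
      (by simp)).continuousOn_mul (Continuous.continuousOn (by fun_prop)), Nat.cast_zero]

end IsTrapezoidRegular

/-! ### The functions v ↦ g(b/v)/v and their oscillatory integrals. -/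

namespace IsInversionRegular

variable {g g₁ g₂ : ℝ → ℝ} {K : ℝ}

theorem const_nonneg (h : IsInversionRegular g g₁ g₂ K) : 0 ≤ K := (abs_nonneg _).trans (h.bound 0)

theorem continuous (h : IsInversionRegular g g₁ g₂ K) : Continuous g :=
  continuous_iff_continuousAt.2 fun x => (h.hasDerivAt x).continuousAt

/-- The second derivative of `v ↦ g (b / v) / v`. -/
noncomputable def invDeriv₂ (g g₁ g₂ : ℝ → ℝ) (b v : ℝ) : ℝ :=
  (2 * (b / v) ^ 3 * g (b / v) + 4 * (b / v) ^ 4 * g₁ (b / v) + (b / v) ^ 5 * g₂ (b / v)) / b ^ 3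

theorem abs_invDeriv₂_le (h : IsInversionRegular g g₁ g₂ K) {b : ℝ} (hb : 0 < b) {v : ℝ}
    (hv : 0 < v) : |invDeriv₂ g g₁ g₂ b v| ≤ 8 * K / b ^ 3 * (1 + (b⁻¹ * v) ^ 2)⁻¹ := by
  obtain ⟨x, hx⟩ : ∃ x, x = b / v := ⟨_, rfl⟩
  have hx0 : 0 < x := hx ▸ div_pos hb hv
  have hvx : b⁻¹ * v = 1 / x := by rw [hx]; field_simp
  have hK := h.const_nonneg
  rw [invDeriv₂, hvx, ← hx, abs_div, abs_of_pos (pow_pos hb 3), div_mul_eq_mul_div]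
  gcongr
  rw [← div_eq_mul_inv, le_div_iff₀ (by positivity)]
  have hd := h.decay₂ x
  obtain ⟨A, hA⟩ : ∃ A, A = |2 * x ^ 3 * g x + 4 * x ^ 4 * g₁ x + x ^ 5 * g₂ x| := ⟨_, rfl⟩
  rw [← hA] at hd ⊢
  have hA0 : 0 ≤ A := hA ▸ abs_nonneg _
  -- For x ≤ 1 the bounds on g, g₁, g₂ give A ≤ (2 + 4 + 1)K x², which together with A ≤ K yields
  -- 8K. For x ≥ 1 the bound A ≤ K suffices.
  rcases le_total x 1 with h1 | h1
  · have e : A ≤ 7 * K * x ^ 2 := by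
      have p1 : x ^ 3 ≤ x ^ 2 := pow_le_pow_of_le_one hx0.le h1 (by norm_num)
      have p2 : x ^ 4 ≤ x ^ 2 := pow_le_pow_of_le_one hx0.le h1 (by norm_num)
      have p3 : x ^ 5 ≤ x ^ 2 := pow_le_pow_of_le_one hx0.le h1 (by norm_num)
      calc A ≤ |2 * x ^ 3 * g x| + |4 * x ^ 4 * g₁ x| + |x ^ 5 * g₂ x| := hA ▸ abs_add_three _ _ _
        _ = 2 * x ^ 3 * |g x| + 4 * x ^ 4 * |g₁ x| + x ^ 5 * |g₂ x| := by
          rw [abs_mul (2 * x ^ 3), abs_mul (4 * x ^ 4), abs_mul (x ^ 5),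
            abs_of_pos (by positivity : 0 < 2 * x ^ 3), abs_of_pos (by positivity : 0 < 4 * x ^ 4),
            abs_of_pos (by positivity : 0 < x ^ 5)]
        _ ≤ 2 * x ^ 2 * K + 4 * x ^ 2 * K + x ^ 2 * K := by
          gcongr
          exacts [h.bound x, h.bound₁ x, h.bound₂ x]
        _ = _ := by ring
    have : A * (1 / x) ^ 2 ≤ 7 * K := by
      rw [one_div, inv_pow, ← div_eq_mul_inv, div_le_iff₀ (by positivity)]; exact e
    linarith
  · have : (1 / x) ^ 2 ≤ 1 := pow_le_one₀ (by positivity) (by rwa [div_le_one hx0])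
    nlinarith

theorem integrable_bound {b : ℝ} (hb : 0 < b) :
    Integrable fun v : ℝ => 8 * K / b ^ 3 * (1 + (b⁻¹ * v) ^ 2)⁻¹ :=
  ((integrable_comp_mul_left_iff (fun v : ℝ => (1 + v ^ 2)⁻¹) (inv_ne_zero hb.ne')).2
    integrable_inv_one_add_sq).const_mul _

/-- The value at v = 0, which is 0 by the convention on division, agrees with the limit because
|g(b/v)/v| ≤ Kv/b². The conditions on the derivatives only concern v > 0. -/
theorem isTrapezoidRegular (h : IsInversionRegular g g₁ g₂ K) {b : ℝ} (hb : 0 < b) :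
    IsTrapezoidRegular (fun v => g (b / v) / v)
      (fun v => -(((b / v) ^ 2 * g (b / v) + (b / v) ^ 3 * g₁ (b / v)) / b ^ 2))
      (invDeriv₂ g g₁ g₂ b) := by
  have hK := h.const_nonneg
  have hd : ∀ v, 0 < v → HasDerivAt (fun v => b / v) (-(b / v) ^ 2 / b) v := fun v hv => by
    refine ((hasDerivAt_const v b).div (hasDerivAt_id v) hv.ne').congr_deriv ?_
    simp; field_simp
  have hinf : Tendsto (fun v : ℝ => b / v) atTop (𝓝 0) := tendsto_const_nhds.div_atTop tendsto_id
  have hg : Tendsto (fun v : ℝ => g (b / v)) atTop (𝓝 (g 0)) :=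
    ((h.hasDerivAt 0).continuousAt.tendsto).comp hinf
  have hg1 : Tendsto (fun v : ℝ => g₁ (b / v)) atTop (𝓝 (g₁ 0)) :=
    ((h.hasDerivAt₁ 0).continuousAt.tendsto).comp hinf
  refine ⟨by simp, fun v hv => ?_, fun v hv => ?_, ⟨2 * K / b ^ 2, fun v hv => ⟨?_, ?_⟩⟩, ?_, ?_, ?_⟩
  · refine (((h.hasDerivAt _).comp v (hd v hv)).div (hasDerivAt_id v) hv.ne').congr_deriv ?_
    simp
    field_simp
    ring
  · have e := hd v hv
    have e1 := (h.hasDerivAt (b / v)).comp v e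
    have e2 := (h.hasDerivAt₁ (b / v)).comp v e
    refine (((((e.pow 2).mul e1).add ((e.pow 3).mul e2)).div_const (b ^ 2)).neg).congr_deriv ?_
    simp [invDeriv₂]
    field_simp
    ring
  · have := h.decay (b / v)
    rw [div_pow, div_mul_eq_mul_div, div_le_iff₀ (by positivity)] at this
    rw [abs_div, abs_of_pos hv, div_le_iff₀ hv, div_mul_eq_mul_div, div_mul_eq_mul_div,
      le_div_iff₀ (by positivity)]
    nlinarith [mul_nonneg hK (sq_nonneg v)]
  · rw [abs_neg, abs_div, abs_of_pos (pow_pos hb 2)]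
    gcongr
    have := h.decay (b / v)
    have := h.decay₁ (b / v)
    have := abs_add_le ((b / v) ^ 2 * g (b / v)) ((b / v) ^ 3 * g₁ (b / v))
    rw [abs_mul, abs_of_nonneg (sq_nonneg (b / v))] at this
    linarith
  · have hm : AEStronglyMeasurable (invDeriv₂ g g₁ g₂ b) volume := by
      have m0 : Measurable g := h.continuous.measurable
      have m1 : Measurable g₁ := by
        have : g₁ = deriv g := funext fun x => (h.hasDerivAt x).deriv.symm
        exact this ▸ measurable_deriv g
      have m2 : Measurable g₂ := by
        have : g₂ = deriv g₁ := funext fun x => (h.hasDerivAt₁ x).deriv.symm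
        exact this ▸ measurable_deriv g₁
      unfold invDeriv₂
      exact Measurable.aestronglyMeasurable (by fun_prop)
    refine (integrable_bound (K := K) hb).integrableOn.mono' hm.restrict ?_
    filter_upwards [ae_restrict_mem measurableSet_Ioi] with v hv
    exact h.abs_invDeriv₂_le hb hv
  · exact hg.div_atTop tendsto_id
  · have := ((((hinf.pow 2).mul hg).add ((hinf.pow 3).mul hg1)).div_const (b ^ 2)).neg
    simpa using this

theorem integral_abs_invDeriv₂_le (h : IsInversionRegular g g₁ g₂ K) {b : ℝ} (hb : 0 < b) :
    ∫ v in Ioi (0 : ℝ), |invDeriv₂ g g₁ g₂ b v| ≤ 8 * Real.pi * K / b ^ 2 := by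
  have hK := h.const_nonneg
  calc _ ≤ ∫ v in Ioi (0 : ℝ), 8 * K / b ^ 3 * (1 + (b⁻¹ * v) ^ 2)⁻¹ :=
        setIntegral_mono_on (h.isTrapezoidRegular hb).integrableOn₂.abs
          (integrable_bound hb).integrableOn measurableSet_Ioi fun v hv => h.abs_invDeriv₂_le hb hv
    _ ≤ ∫ v : ℝ, 8 * K / b ^ 3 * (1 + (b⁻¹ * v) ^ 2)⁻¹ :=
        setIntegral_le_integral (integrable_bound hb) (ae_of_all _ fun v => by positivity)
    _ = _ := by
        rw [integral_const_mul, Measure.integral_comp_mul_left (fun v : ℝ => (1 + v ^ 2)⁻¹),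
          integral_univ_inv_one_add_sq, inv_inv, abs_of_pos hb, smul_eq_mul]
        field_simp

theorem setIntegral_cos_inv (g : ℝ → ℝ) {a b ε : ℝ} (hb : 0 < b) (hε : 0 < ε) :
    ∫ x in Ioi ε, Real.cos (a * b / x) * g x / x
      = ∫ v in 0..(b / ε), Real.cos (a * v) * (g (b / v) / v) := by
  have himg : (fun v => b / v) '' Ioo 0 (b / ε) = Ioi ε := by
    ext x
    constructor
    · rintro ⟨v, ⟨hv0, hv⟩, rfl⟩
      rw [lt_div_iff₀ hε] at hv
      rw [mem_Ioi, lt_div_iff₀ hv0]; linarith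
    · intro hx
      have hx0 : 0 < x := hε.trans hx
      exact ⟨b / x, ⟨by positivity, div_lt_div_of_pos_left hb hε hx⟩, by field_simp⟩
  rw [intervalIntegral.integral_of_le (by positivity), integral_Ioc_eq_integral_Ioo, ← himg,
    integral_image_eq_integral_abs_deriv_smul measurableSet_Ioo (f' := fun v => -b / v ^ 2)]
  · refine setIntegral_congr_fun measurableSet_Ioo fun v hv => ?_
    have hv0 : 0 < v := hv.1
    have e : a * b / (b / v) = a * v := by field_simp
    simp only [smul_eq_mul, e]
    rw [abs_div, abs_neg, abs_of_pos hb, abs_of_pos (pow_pos hv0 2)]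
    field_simp
  · intro v hv
    have hv0 : v ≠ 0 := hv.1.ne'
    refine (((hasDerivAt_const v b).div (hasDerivAt_id v) hv0).congr_deriv ?_).hasDerivWithinAt
    simp
  · intro v hv w hw hvw
    have := hv.1.ne'; have := hw.1.ne'
    simp only at hvw
    field_simp at hvw
    exact hvw.symm

/-- The value of the improper integral of `x ↦ cos (a * b / x) * g x / x`. -/
noncomputable def cosInvIntegral (g g₁ g₂ : ℝ → ℝ) (a b : ℝ) : ℝ :=
  1 / a ^ 2 * ∫ v in Ioi (0 : ℝ), (1 - Real.cos (a * v)) * invDeriv₂ g g₁ g₂ b v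

/-- Under x = b/v the cutoff ε becomes V = b/ε → ∞. Away from 0 the integrand is dominated by K x⁻³.
-/
theorem hasImproperIntegral (h : IsInversionRegular g g₁ g₂ K) {a b : ℝ} (ha : 0 < a)
    (hb : 0 < b) : HasImproperIntegral (fun x => Real.cos (a * b / x) * g x / x)
      (cosInvIntegral g g₁ g₂ a b) := by
  refine ⟨fun ε hε => ?_, ?_⟩
  · have hi : IntegrableOn (fun x : ℝ => K * x ^ (-3 : ℝ)) (Ioi ε) :=
      (integrableOn_Ioi_rpow_of_lt (by norm_num) hε).const_mul K
    have hm := h.continuous.measurable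
    refine hi.mono' (Measurable.aestronglyMeasurable (by fun_prop)) ?_
    filter_upwards [ae_restrict_mem measurableSet_Ioi] with x hx
    have hx0 : 0 < x := hε.trans hx
    rw [norm_div, norm_mul, Real.norm_of_nonneg hx0.le, Real.norm_eq_abs, Real.norm_eq_abs,
      show (-3 : ℝ) = -((3 : ℕ) : ℝ) by norm_num, Real.rpow_neg hx0.le, Real.rpow_natCast,
      ← div_eq_mul_inv, div_le_div_iff₀ hx0 (by positivity)]
    have := h.decay x
    have hc : |Real.cos (a * b / x)| * |g x| ≤ |g x| :=
      mul_le_of_le_one_left (abs_nonneg _) (Real.abs_cos_le_one _)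
    calc |Real.cos (a * b / x)| * |g x| * x ^ 3 ≤ |g x| * x ^ 3 := by gcongr
      _ = x ^ 2 * |g x| * x := by ring
      _ ≤ K * x := by gcongr
  · have ht : Tendsto (fun ε : ℝ => b / ε) (𝓝[>] 0) atTop := by
      simpa [div_eq_mul_inv] using tendsto_inv_nhdsGT_zero.const_mul_atTop hb
    refine (((h.isTrapezoidRegular hb).tendsto_integral_cos_mul ha).comp ht).congr' ?_
    filter_upwards [self_mem_nhdsWithin] with ε hε
    rw [Function.comp, setIntegral_cos_inv g hb hε]

theorem abs_cosInvIntegral_le (h : IsInversionRegular g g₁ g₂ K) {a b : ℝ} (ha : 0 < a)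
    (hb : 0 < b) : |cosInvIntegral g g₁ g₂ a b| ≤ 16 * Real.pi * K / (a * b) ^ 2 := by
  have h1 := (h.isTrapezoidRegular hb).tendsto_integral_one_sub_cos_mul a
  have h2 : |∫ v in Ioi (0 : ℝ), (1 - Real.cos (a * v)) * invDeriv₂ g g₁ g₂ b v|
      ≤ 16 * Real.pi * K / b ^ 2 := by
    refine le_of_tendsto h1.abs ?_
    filter_upwards [eventually_ge_atTop 0] with V hV
    refine ((h.isTrapezoidRegular hb).abs_integral_one_sub_cos_mul_le a hV).trans ?_
    have := h.integral_abs_invDeriv₂_le hb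
    calc _ ≤ 2 * (8 * Real.pi * K / b ^ 2) := by gcongr
      _ = _ := by ring
  rw [cosInvIntegral, abs_mul, abs_of_pos (by positivity : 0 < 1 / a ^ 2)]
  calc _ ≤ 1 / a ^ 2 * (16 * Real.pi * K / b ^ 2) := by gcongr
    _ = _ := by rw [mul_pow, div_mul_div_comm, one_mul]

end IsInversionRegular

/-! ### Double sums over factorisations, and the limit M → ∞. -/

theorem HasImproperIntegral.unique {f : ℝ → ℝ} {I J : ℝ} (hI : HasImproperIntegral f I)
    (hJ : HasImproperIntegral f J) : I = J := tendsto_nhds_unique hI.2 hJ.2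

theorem summable_prod_inv_sq : Summable fun p : ℕ+ × ℕ+ => 1 / ((p.1 : ℝ) * p.2) ^ 2 := by
  refine (summable_pnat_inv_sq.mul_of_nonneg summable_pnat_inv_sq (fun _ => by positivity)
    (fun _ => by positivity)).congr fun p => ?_
  rw [mul_pow, div_mul_div_comm, one_mul]

/-- Sum over all products of two positive integers versus sum weighted by the number of divisors. -/
theorem hasSum_card_divisors_mul {f : ℕ → ℝ} (hf : Summable fun p : ℕ+ × ℕ+ => f (p.1 * p.2)) :
    HasSum (fun n : ℕ+ => ((n : ℕ).divisors.card : ℝ) * f n)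
      (∑' p : ℕ+ × ℕ+, f (p.1 * p.2)) := by
  have h1 := (sigmaAntidiagonalEquivProd.hasSum_iff).2 hf.hasSum
  refine (h1.sigma fun n => hasSum_fintype _).congr_fun fun n => ?_
  have : ∀ c : Nat.divisorsAntidiagonal n,
      ((fun p : ℕ+ × ℕ+ => f (p.1 * p.2)) ∘ sigmaAntidiagonalEquivProd) ⟨n, c⟩ = f n := fun c => by
    have := divisorsAntidiagonalFactors_eq c
    simp only [Function.comp]
    exact congrArg f this
  rw [Finset.sum_congr rfl fun c _ => this c]
  have hcard : (n : ℕ).divisors.card = (n : ℕ).divisorsAntidiagonal.card := by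
    rw [← Nat.map_div_right_divisors, Finset.card_map]
  simp [hcard]

namespace IsInversionRegular

variable {g g₁ g₂ : ℝ → ℝ} {K : ℝ}

theorem summable_cosInvIntegral (h : IsInversionRegular g g₁ g₂ K) {c : ℝ} (hc : 0 < c) :
    Summable fun p : ℕ+ × ℕ+ =>
      cosInvIntegral g g₁ g₂ (2 * Real.pi * (p.1 * p.2 : ℕ)) c := by
  refine Summable.of_norm_bounded
    (summable_prod_inv_sq.mul_left (16 * Real.pi * K / (2 * Real.pi * c) ^ 2)) fun p => ?_
  have h1 : (0 : ℝ) < p.1 := by exact_mod_cast p.1.pos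
  have h2 : (0 : ℝ) < p.2 := by exact_mod_cast p.2.pos
  refine (h.abs_cosInvIntegral_le (a := 2 * Real.pi * (p.1 * p.2 : ℕ))
    (by push_cast; positivity) hc).trans_eq ?_
  push_cast
  field_simp

/-- The defining formula separates a and b, but the improper integral that it evaluates involves
only the product ab. This is where divisor sums come from. -/
theorem cosInvIntegral_congr (h : IsInversionRegular g g₁ g₂ K) {a b a' b' : ℝ} (ha : 0 < a)
    (hb : 0 < b) (ha' : 0 < a') (hb' : 0 < b') (e : a * b = a' * b') :
    cosInvIntegral g g₁ g₂ a b = cosInvIntegral g g₁ g₂ a' b' := by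
  have := h.hasImproperIntegral ha hb
  rw [e] at this
  exact this.unique (h.hasImproperIntegral ha' hb')

/-- The trapezoid defects of `v ↦ g (c j / v) / v` on `[0, M]`, summed over `j`, converge. -/
theorem tendsto_tsum_trapezoid (h : IsInversionRegular g g₁ g₂ K) {c : ℝ} (hc : 0 < c) :
    Tendsto (fun M : ℕ => ∑' j : ℕ+, (∑ m ∈ Finset.range M, g (c * j / (m + 1 : ℕ)) / (m + 1 : ℕ)
        - g (c * j / M) / M / 2 - ∫ v in (0 : ℝ)..M, g (c * j / v) / v)) atTop
      (𝓝 (2 * ∑' n : ℕ+, ((n : ℕ).divisors.card : ℝ) *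
        cosInvIntegral g g₁ g₂ (2 * Real.pi * n) c)) := by
  have hcj : ∀ j : ℕ+, 0 < c * j := fun j => mul_pos hc (by exact_mod_cast j.pos)
  have hk : ∀ j : ℕ+, (0 : ℝ) < 2 * Real.pi * j := fun j =>
    mul_pos Real.two_pi_pos (by exact_mod_cast j.pos)
  obtain ⟨t, ht⟩ : ∃ t : ℕ → ℕ+ × ℕ+ → ℝ, t = fun (M : ℕ) (p : ℕ+ × ℕ+) => 2 / (2 * Real.pi * p.2) ^ 2 *
      ∫ v in (0 : ℝ)..M, (1 - Real.cos (2 * Real.pi * p.2 * v)) * invDeriv₂ g g₁ g₂ (c * p.1) v :=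
    ⟨_, rfl⟩
  have hb : Summable fun p : ℕ+ × ℕ+ =>
      32 * Real.pi * K / (2 * Real.pi * c) ^ 2 * (1 / ((p.1 : ℝ) * p.2) ^ 2) :=
    summable_prod_inv_sq.mul_left _
  have hbound : ∀ M p, ‖t M p‖
      ≤ 32 * Real.pi * K / (2 * Real.pi * c) ^ 2 * (1 / ((p.1 : ℝ) * p.2) ^ 2) := by
    intro M p
    have h1 : (0 : ℝ) < p.1 := by exact_mod_cast p.1.pos
    have h2 : (0 : ℝ) < p.2 := by exact_mod_cast p.2.pos
    have e1 := (h.isTrapezoidRegular (hcj p.1)).abs_integral_one_sub_cos_mul_le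
      (2 * Real.pi * p.2) (Nat.cast_nonneg M)
    have e2 := h.integral_abs_invDeriv₂_le (hcj p.1)
    rw [ht, norm_mul, Real.norm_of_nonneg (by positivity), Real.norm_eq_abs]
    calc _ ≤ 2 / (2 * Real.pi * p.2) ^ 2 * (2 * (8 * Real.pi * K / (c * p.1) ^ 2)) := by
          gcongr; exact e1.trans (by gcongr)
      _ = _ := by field_simp; ring
  have hlim : ∀ p, Tendsto (fun M => t M p) atTop
      (𝓝 (2 * cosInvIntegral g g₁ g₂ (2 * Real.pi * (p.1 * p.2 : ℕ)) c)) := by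
    intro p
    have h1 : (0 : ℝ) < p.1 := by exact_mod_cast p.1.pos
    have h2 : (0 : ℝ) < p.2 := by exact_mod_cast p.2.pos
    -- The factor j moves from the frequency 2πjk to the scale cj.
    rw [h.cosInvIntegral_congr (a' := 2 * Real.pi * p.2) (b' := c * p.1)
      (by push_cast; positivity) hc (hk _) (hcj _) (by push_cast; ring)]
    have := (((h.isTrapezoidRegular (hcj p.1)).tendsto_integral_one_sub_cos_mul
      (2 * Real.pi * p.2)).comp tendsto_natCast_atTop_atTop).const_mul
        (2 / (2 * Real.pi * p.2) ^ 2)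
    have e : 2 * cosInvIntegral g g₁ g₂ (2 * Real.pi * p.2) (c * p.1)
        = 2 / (2 * Real.pi * p.2) ^ 2 * ∫ v in Ioi (0 : ℝ),
          (1 - Real.cos (2 * Real.pi * p.2 * v)) * invDeriv₂ g g₁ g₂ (c * p.1) v := by
      unfold cosInvIntegral
      ring
    rw [ht, e]
    exact this
  have hT := tendsto_tsum_of_dominated_convergence (f := t) hb hlim
    (Eventually.of_forall fun M => hbound M)
  rw [tsum_mul_left] at hT
  have hD := (hasSum_card_divisors_mul
    (f := fun n => cosInvIntegral g g₁ g₂ (2 * Real.pi * n) c) (h.summable_cosInvIntegral hc)).tsum_eq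
  rw [hD]
  refine hT.congr fun M => ?_
  have hs : Summable (t M) := Summable.of_norm_bounded hb (hbound M)
  -- Absolute summability over pairs allows summing over k first, which recovers the trapezoid
  -- defect for each j.
  rw [hs.tsum_prod]
  refine tsum_congr fun j => ?_
  have := ((h.isTrapezoidRegular (hcj j)).hasSum_integral M).tsum_eq
  rw [← this, ht]

end IsInversionRegular

/-! ### Poisson summation. -/

section Poisson

open scoped FourierTransform

theorem isBigO_rpow_neg_two_of_sq_mul_le {f : ℝ → ℂ} {C : ℝ} (h : ∀ x, x ^ 2 * ‖f x‖ ≤ C) :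
    f =O[cocompact ℝ] (|·| ^ (-2 : ℝ)) := by
  refine Asymptotics.IsBigO.of_bound C ?_
  filter_upwards [(isCompact_singleton (x := (0 : ℝ))).compl_mem_cocompact] with x hx
  have hx0 : 0 < |x| := abs_pos.2 hx
  rw [Real.norm_of_nonneg (Real.rpow_nonneg (abs_nonneg x) _),
    show (-2 : ℝ) = -((2 : ℕ) : ℝ) by norm_num, Real.rpow_neg (abs_nonneg x), Real.rpow_natCast,
    ← div_eq_mul_inv, le_div_iff₀ (by positivity), mul_comm, sq_abs]
  exact h x

theorem fourierHat_comp_mul (F : ℝ → ℝ) {w : ℝ} (hw : 0 < w) (x : ℝ) :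
    fourierHat (fun u => F (w * u)) x = fourierHat F (x / w) / w := by
  have := integral_comp_mul_left_Ioi (fun u => F u * Real.cos (x / w * u)) 0 hw
  rw [mul_zero] at this
  rw [fourierHat, fourierHat, mul_div_assoc, div_eq_inv_mul, ← smul_eq_mul (w⁻¹), ← this]
  congr 2
  ext u
  congr 2
  field_simp

/-- Poisson summation for x ↦ F(wx), folded onto positive indices by evenness. The version needing
only inverse-square decay of the function and its transform is used, since F may have a corner at 0.
-/
theorem tsum_fourierHat_div {F : ℝ → ℝ} {C : ℝ} (hc : Continuous F) (hEven : Function.Even F)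
    (hi : Integrable F) (hF : ∀ x, x ^ 2 * |F x| ≤ C) (hF' : ∀ x, x ^ 2 * |fourierHat F x| ≤ C)
    {w : ℝ} (hw : 0 < w) :
    ∑' j : ℕ+, fourierHat F (2 * Real.pi * j / w)
      = w * (F 0 / 2 + ∑' k : ℕ+, F (k * w)) - fourierHat F 0 / 2 := by
  obtain ⟨f, hf⟩ : ∃ f : ℝ → ℂ, f = fun x => ((F (w * x) : ℝ) : ℂ) := ⟨_, rfl⟩
  have hev : Function.Even fun u => F (w * u) := fun u => by simp only [mul_neg, hEven (w * u)]
  have hfour : ∀ ξ, 𝓕 f ξ = ((fourierHat F (2 * Real.pi * ξ / w) / w : ℝ) : ℂ) := fun ξ => by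
    rw [← fourierHat_comp_mul F hw, fourierHat_eq_integral_exp hev (hi.comp_mul_left' hw.ne'),
      Real.fourier_real_eq_integral_exp_smul]
    congr 1
    ext v
    rw [hf, smul_eq_mul, mul_comm]
    congr 2
    push_cast
    ring
  have hO : f =O[cocompact ℝ] (|·| ^ (-2 : ℝ)) :=
    isBigO_rpow_neg_two_of_sq_mul_le (C := C / w ^ 2) fun x => by
      rw [hf, Complex.norm_real, Real.norm_eq_abs, le_div_iff₀ (by positivity)]
      have := hF (w * x)
      rw [mul_pow] at this
      linarith
  have hO' : (𝓕 f) =O[cocompact ℝ] (|·| ^ (-2 : ℝ)) :=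
    isBigO_rpow_neg_two_of_sq_mul_le (C := C * w / (2 * Real.pi) ^ 2) fun ξ => by
      rw [hfour, Complex.norm_real, Real.norm_eq_abs, abs_div, abs_of_pos hw,
        le_div_iff₀ (by positivity)]
      have := hF' (2 * Real.pi * ξ / w)
      rw [div_pow, div_mul_eq_mul_div, div_le_iff₀ (by positivity)] at this
      rw [← mul_div_assoc, div_mul_eq_mul_div, div_le_iff₀ hw]
      nlinarith
  have key := Real.tsum_eq_tsum_fourier_of_rpow_decay (by rw [hf]; fun_prop) one_lt_two hO hO' 0
  have hs : Summable fun n : ℤ => F (w * n) := by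
    have := summable_of_isBigO (Real.summable_abs_int_rpow one_lt_two)
      (hO.comp_tendsto Int.tendsto_coe_cofinite)
    rw [← Complex.summable_ofReal]
    exact this.congr fun n => by simp [hf]
  have hs' : Summable fun n : ℤ => fourierHat F (2 * Real.pi * n / w) / w := by
    have := summable_of_isBigO (Real.summable_abs_int_rpow one_lt_two)
      (hO'.comp_tendsto Int.tendsto_coe_cofinite)
    rw [← Complex.summable_ofReal]
    exact this.congr fun n => by simp [hfour]
  have key2 : ∑' n : ℤ, F (w * n) = ∑' n : ℤ, fourierHat F (2 * Real.pi * n / w) / w := by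
    have e1 : ∀ n : ℤ, f (0 + n) = ((F (w * n) : ℝ) : ℂ) := fun n => by simp [hf]
    have e2 : ∀ n : ℤ, 𝓕 f n * fourier n ((0 : ℝ) : UnitAddCircle)
        = ((fourierHat F (2 * Real.pi * n / w) / w : ℝ) : ℂ) := fun n => by simp [hfour]
    simp only [e1, e2] at key
    exact_mod_cast key
  have hhat : ∀ x, fourierHat F (-x) = fourierHat F x := fun x => by simp [fourierHat]
  rw [tsum_int_eq_zero_add_two_mul_tsum_pnat (fun n => by
      simp only [Int.cast_neg, mul_neg, hEven (w * n)]) hs,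
    tsum_int_eq_zero_add_two_mul_tsum_pnat (fun n => by
      simp only [Int.cast_neg, mul_neg, neg_div, hhat]) hs', tsum_div_const] at key2
  simp only [Int.cast_zero, mul_zero, zero_div, Int.cast_natCast, two_nsmul] at key2
  have e : ∑' n : ℕ+, F (w * n) = ∑' k : ℕ+, F (k * w) := tsum_congr fun k => by rw [mul_comm]
  rw [e] at key2
  generalize ∑' k : ℕ+, F (k * w) = A at key2 ⊢
  field_simp at key2
  linarith

end Poisson

/-! ### Harmonic numbers and the logarithmic term. -/

theorem hasSum_ite_inv_harmonic {x : ℝ} (hx : 0 ≤ x) :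
    HasSum (fun k : ℕ+ => if (k : ℝ) ≤ x then 1 / (k : ℝ) else 0) (harmonic ⌊x⌋₊ : ℝ) := by
  have h : HasSum (fun n : ℕ => if ((n + 1 : ℕ) : ℝ) ≤ x then 1 / ((n + 1 : ℕ) : ℝ) else 0)
      (∑ n ∈ Finset.range ⌊x⌋₊,
        if ((n + 1 : ℕ) : ℝ) ≤ x then 1 / ((n + 1 : ℕ) : ℝ) else 0) := by
    refine hasSum_sum_of_ne_finset_zero fun n hn => if_neg fun hle => hn ?_
    rw [Finset.mem_range]
    exact Nat.le_floor hle
  have e : ∑ n ∈ Finset.range ⌊x⌋₊, (if ((n + 1 : ℕ) : ℝ) ≤ x then 1 / ((n + 1 : ℕ) : ℝ) else 0)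
      = (harmonic ⌊x⌋₊ : ℝ) := by
    rw [harmonic, Rat.cast_sum]
    refine Finset.sum_congr rfl fun n hn => ?_
    rw [if_pos ((Nat.le_floor_iff hx).1 (Finset.mem_range.1 hn))]
    push_cast
    rw [one_div]
  rw [e] at h
  refine (Equiv.pnatEquivNat.hasSum_iff.2 h).congr_fun fun k => ?_
  simp [Function.comp]

theorem tendsto_harmonic_floor_sub_log :
    Tendsto (fun x : ℝ => (harmonic ⌊x⌋₊ : ℝ) - Real.log x) atTop
      (𝓝 Real.eulerMascheroniConstant) := by
  have h1 := Real.tendsto_harmonic_sub_log.comp (tendsto_nat_floor_atTop (α := ℝ))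
  have h2 : Tendsto (fun x : ℝ => Real.log (⌊x⌋₊ / x)) atTop (𝓝 0) := by
    simpa using (tendsto_nat_floor_div_atTop (R := ℝ)).log one_ne_zero
  have h3 := h1.add h2
  rw [add_zero] at h3
  refine h3.congr' ?_
  filter_upwards [eventually_ge_atTop 1] with x hx
  have hf : (⌊x⌋₊ : ℝ) ≠ 0 := by exact_mod_cast (Nat.floor_pos.2 hx).ne'
  rw [Real.log_div hf (by positivity)]
  simp

/-- A crude majorant: it makes P(u) H_{⌊u/t⌋} integrable and the tail O(1/t). -/
theorem harmonic_floor_le {x : ℝ} (hx : 0 ≤ x) : (harmonic ⌊x⌋₊ : ℝ) ≤ x := by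
  rcases lt_or_ge x 1 with h | h
  · simpa [Nat.floor_eq_zero.2 h] using hx
  · linarith [harmonic_floor_le_one_add_log x h, Real.log_le_sub_one_of_pos (by linarith : 0 < x)]

theorem harmonic_nonneg (n : ℕ) : (0 : ℝ) ≤ harmonic n := by
  exact_mod_cast Finset.sum_nonneg fun i _ => by positivity

/-- `∑ (1 / k) ∫_{k t}^∞ p`, written as a single integral. -/
noncomputable def harmonicTail (p : ℝ → ℝ) (t : ℝ) : ℝ :=
  ∫ u in Ioi (0 : ℝ), p u * harmonic ⌊u / t⌋₊

namespace IsRapidJet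

variable {P : ℕ → ℝ → ℝ}

theorem integrableOn_mul_id (h : IsRapidJet P) : IntegrableOn (fun u => |P 0 u| * u) (Ioi 0) := by
  refine IntegrableOn.congr_fun (h.mulId.integrableOn 0).abs (fun u hu => ?_) measurableSet_Ioi
  have : 0 < u := hu
  simp [mulIdJet, abs_mul, abs_of_pos this, mul_comm]

theorem measurable_harmonic_floor_div (t : ℝ) :
    Measurable fun u : ℝ => (harmonic ⌊u / t⌋₊ : ℝ) :=
  (measurable_from_nat (f := fun n : ℕ => (harmonic n : ℝ))).comp
    (Nat.measurable_floor.comp (measurable_id.div_const t))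

theorem integrableOn_mul_harmonic (h : IsRapidJet P) {t : ℝ} (ht : 0 < t) :
    IntegrableOn (fun u => P 0 u * harmonic ⌊u / t⌋₊) (Ioi 0) := by
  refine (h.integrableOn_mul_id.div_const t).mono'
    ((h.aestronglyMeasurable 0).mul (measurable_harmonic_floor_div t).aestronglyMeasurable) ?_
  filter_upwards [ae_restrict_mem measurableSet_Ioi] with u hu
  have hu : 0 < u := hu
  rw [norm_mul, Real.norm_of_nonneg (harmonic_nonneg _), mul_div_assoc]
  exact mul_le_mul_of_nonneg_left (harmonic_floor_le (by positivity)) (norm_nonneg _)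

theorem abs_harmonicTail_le (h : IsRapidJet P) {t : ℝ} (ht : 0 < t) :
    |harmonicTail (P 0) t| ≤ (∫ u in Ioi (0 : ℝ), |P 0 u| * u) / t := by
  rw [← integral_div]
  refine abs_integral_le_integral_abs.trans
    (setIntegral_mono_on (h.integrableOn_mul_harmonic ht).abs (h.integrableOn_mul_id.div_const t)
      measurableSet_Ioi fun u hu => ?_)
  have hu : 0 < u := hu
  rw [abs_mul, abs_of_nonneg (harmonic_nonneg _), mul_div_assoc]
  exact mul_le_mul_of_nonneg_left (harmonic_floor_le (by positivity)) (abs_nonneg _)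

theorem tendsto_harmonicTail_atTop (h : IsRapidJet P) :
    Tendsto (harmonicTail (P 0)) atTop (𝓝 0) := by
  refine squeeze_zero_norm' ?_
    (tendsto_const_nhds.div_atTop tendsto_id :
      Tendsto (fun t : ℝ => (∫ u in Ioi (0 : ℝ), |P 0 u| * u) / t) atTop (𝓝 0))
  filter_upwards [eventually_gt_atTop 0] with t ht
  exact h.abs_harmonicTail_le ht

/-- After exchanging sum and integral, a point u collects the weight Σ_{k ≤ u/t} 1/k. -/
theorem hasSum_harmonicTail (h : IsRapidJet P) {t : ℝ} (ht : 0 < t) :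
    HasSum (fun k : ℕ+ => 1 / (k : ℝ) * ∫ u in Ioi (k * t), P 0 u) (harmonicTail (P 0) t) := by
  have hx : ∀ u : ℝ, 0 < u → HasSum (fun k : ℕ+ => if (k : ℝ) ≤ u / t then 1 / (k : ℝ) else 0)
      (harmonic ⌊u / t⌋₊ : ℝ) := fun u hu => hasSum_ite_inv_harmonic (by positivity)
  have hmeas : ∀ k : ℕ+, Measurable fun u : ℝ => if (k : ℝ) ≤ u / t then 1 / (k : ℝ) else 0 :=
    fun k => Measurable.ite (measurableSet_le measurable_const (measurable_id.div_const t))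
      measurable_const measurable_const
  have key := hasSum_integral_of_dominated_convergence (μ := volume.restrict (Ioi (0 : ℝ)))
    (F := fun (k : ℕ+) u => P 0 u * if (k : ℝ) ≤ u / t then 1 / (k : ℝ) else 0)
    (f := fun u => P 0 u * harmonic ⌊u / t⌋₊)
    (fun k u => |P 0 u| * if (k : ℝ) ≤ u / t then 1 / (k : ℝ) else 0)
    (fun k => (h.aestronglyMeasurable 0).mul (hmeas k).aestronglyMeasurable)
    (fun k => ae_of_all _ fun u => by
      rw [norm_mul, Real.norm_eq_abs, Real.norm_of_nonneg]
      split_ifs <;> positivity)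
    (by
      filter_upwards [ae_restrict_mem measurableSet_Ioi] with u hu
      exact (hx u hu).summable.mul_left _)
    (by
      refine (h.integrableOn_mul_harmonic ht).abs.congr ?_
      filter_upwards [ae_restrict_mem measurableSet_Ioi] with u hu
      rw [tsum_mul_left, (hx u hu).tsum_eq, abs_mul, abs_of_nonneg (harmonic_nonneg _)])
    (by
      filter_upwards [ae_restrict_mem measurableSet_Ioi] with u hu
      exact (hx u hu).mul_left _)
  refine key.congr_fun fun k => ?_
  have hk : (0 : ℝ) < k := by exact_mod_cast k.pos
  have e : ∀ u, P 0 u * (if (k : ℝ) ≤ u / t then 1 / (k : ℝ) else 0)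
      = (Ici (k * t)).indicator (fun u => 1 / (k : ℝ) * P 0 u) u := fun u => by
    simp only [indicator_apply, mem_Ici, le_div_iff₀ ht, mul_comm (P 0 u), ite_mul, zero_mul]
  simp only [e]
  rw [setIntegral_indicator measurableSet_Ici, inter_eq_right.2
    (Ici_subset_Ioi.2 (mul_pos hk ht)), integral_Ici_eq_integral_Ioi, integral_const_mul]

theorem integrableOn_mul_log (h : IsRapidJet P) :
    IntegrableOn (fun u => P 0 u * Real.log u) (Ioi 0) := by
  rw [← Ioc_union_Ioi_eq_Ioi zero_le_one]
  refine IntegrableOn.union ?_ ?_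
  · have hl : IntegrableOn Real.log (Icc 0 1) := by
      rw [integrableOn_Icc_iff_integrableOn_Ioc,
        ← intervalIntegrable_iff_integrableOn_Ioc_of_le zero_le_one]
      exact intervalIntegral.intervalIntegrable_log'
    exact (hl.continuousOn_mul ((h.continuousOn 0).mono Icc_subset_Ici_self)
      isCompact_Icc).mono_set Ioc_subset_Icc_self
  · refine (h.integrableOn_mul_id.mono_set (Ioi_subset_Ioi zero_le_one)).mono'
      (((h.aestronglyMeasurable 0).mono_set (Ioi_subset_Ioi zero_le_one)).mul
        Real.measurable_log.aestronglyMeasurable) ?_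
    filter_upwards [ae_restrict_mem measurableSet_Ioi] with u hu
    have hu : 1 < u := hu
    rw [norm_mul, Real.norm_of_nonneg (Real.log_nonneg hu.le)]
    have := Real.log_le_sub_one_of_pos (by linarith : 0 < u)
    exact mul_le_mul_of_nonneg_left (by linarith) (norm_nonneg _)

theorem integrableOn_mul_log_div_add (h : IsRapidJet P) {y : ℝ} (hy : 0 < y) (c : ℝ) :
    IntegrableOn (fun u => P 0 u * (Real.log (u / y) + c)) (Ioi 0) := by
  refine IntegrableOn.congr_fun
    (h.integrableOn_mul_log.add ((h.integrableOn 0).mul_const (c - Real.log y)))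
    (fun u hu => ?_) measurableSet_Ioi
  rw [Real.log_div (ne_of_gt hu) hy.ne', Pi.add_apply]
  ring

/-- Pointwise, H_{⌊u/(εy)⌋} + ln ε → ln(u/y) + γ: the added logarithm is exactly the divergence of
the tail at 0. -/
theorem tendsto_harmonicTail_add_log (h : IsRapidJet P) {y : ℝ} (hy : 0 < y) :
    Tendsto (fun ε : ℝ => harmonicTail (P 0) (ε * y) + (∫ u in Ioi (0 : ℝ), P 0 u) * Real.log ε)
      (𝓝[>] 0) (𝓝 (∫ u in Ioi (0 : ℝ),
        P 0 u * (Real.log (u / y) + Real.eulerMascheroniConstant))) := by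
  have key := tendsto_integral_filter_of_dominated_convergence (μ := volume.restrict (Ioi (0 : ℝ)))
    (l := 𝓝[>] (0 : ℝ)) (F := fun ε u => P 0 u * (harmonic ⌊u / (ε * y)⌋₊ + Real.log ε))
    (f := fun u => P 0 u * (Real.log (u / y) + Real.eulerMascheroniConstant))
    (fun u => |P 0 u| * (1 + |Real.log (u / y)|))
    (Eventually.of_forall fun ε => (h.aestronglyMeasurable 0).mul
      ((measurable_harmonic_floor_div _).add_const _).aestronglyMeasurable) ?_ ?_ ?_
  · refine key.congr' ?_
    filter_upwards [self_mem_nhdsWithin] with ε hε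
    rw [harmonicTail, ← integral_mul_const, ← integral_add
      (h.integrableOn_mul_harmonic (mul_pos hε hy)) ((h.integrableOn 0).mul_const _)]
    simp only [mul_add]
  · filter_upwards [Ioo_mem_nhdsGT (zero_lt_one (α := ℝ))] with ε ⟨hε, hε1⟩
    filter_upwards [ae_restrict_mem measurableSet_Ioi] with u hu
    have hu : 0 < u := hu
    rw [norm_mul]
    refine mul_le_mul_of_nonneg_left ?_ (norm_nonneg _)
    obtain ⟨x, hx⟩ : ∃ x, x = u / (ε * y) := ⟨_, rfl⟩
    have hx0 : 0 < x := hx ▸ by positivity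
    have hl : Real.log ε = Real.log (u / y) - Real.log x := by
      rw [← Real.log_div (by positivity) hx0.ne', hx]
      congr 1
      field_simp
    rw [← hx, Real.norm_eq_abs]
    -- If x < 1 the harmonic number is 0 and u/y < ε < 1, so |ln ε| ≤ |ln(u/y)|. Otherwise ln x ≤
    -- H_{⌊x⌋} ≤ 1 + ln x.
    rcases lt_or_ge x 1 with h1 | h1
    · have hneg : Real.log x < 0 := Real.log_neg hx0 h1
      rw [Nat.floor_eq_zero.2 h1, harmonic_zero, Rat.cast_zero, zero_add]
      have hlt : Real.log ε < 0 := Real.log_neg hε hε1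
      rw [abs_of_neg hlt]
      linarith [neg_le_abs (Real.log (u / y))]
    · have a1 := log_le_harmonic_floor x hx0.le
      have a2 := harmonic_floor_le_one_add_log x h1
      have a3 := le_abs_self (Real.log (u / y))
      have a4 := neg_abs_le (Real.log (u / y))
      rw [hl, abs_le]
      constructor <;> linarith
  · have := (h.integrableOn 0).abs.add (h.integrableOn_mul_log_div_add hy 0).abs
    refine Integrable.congr this (ae_of_all _ fun u => ?_)
    simp [abs_mul, mul_add]
  · filter_upwards [ae_restrict_mem measurableSet_Ioi] with u hu
    have hu : 0 < u := hu
    have ht : Tendsto (fun ε : ℝ => u / (ε * y)) (𝓝[>] 0) atTop := by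
      refine (tendsto_inv_nhdsGT_zero.const_mul_atTop (div_pos hu hy)).congr fun ε => ?_
      rw [← div_eq_mul_inv, div_div, mul_comm y]
    have := ((tendsto_harmonic_floor_sub_log.comp ht).const_add (Real.log (u / y))).const_mul (P 0 u)
    refine this.congr' ?_
    filter_upwards [self_mem_nhdsWithin] with ε hε
    have hε : 0 < ε := hε
    have hl : Real.log ε = Real.log (u / y) - Real.log (u / (ε * y)) := by
      rw [← Real.log_div (by positivity) (by positivity)]
      congr 1
      field_simp
    rw [hl, Function.comp]
    ring

end IsRapidJet

/-! ### Summation of g(cj/v)/v over j. -/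

namespace IsInversionRegular

variable {g g₁ g₂ : ℝ → ℝ} {K : ℝ}

theorem abs_comp_div_le (h : IsInversionRegular g g₁ g₂ K) {b : ℝ} (hb : 0 < b) {v : ℝ}
    (hv : 0 ≤ v) : |g (b / v) / v| ≤ K * v / b ^ 2 := by
  rcases hv.eq_or_lt with rfl | hv
  · simp
  · have := h.decay (b / v)
    rw [div_pow, div_mul_eq_mul_div, div_le_iff₀ (by positivity)] at this
    rw [abs_div, abs_of_pos hv, div_le_div_iff₀ hv (by positivity)]
    linarith

variable {c : ℝ}

/-- A majorant uniform on [0, V], down to v = 0, for the Weierstrass test and termwise integration.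
-/
theorem abs_comp_mul_div_le (h : IsInversionRegular g g₁ g₂ K) (hc : 0 < c) (j : ℕ+) {v V : ℝ}
    (hv : 0 ≤ v) (hV : v ≤ V) :
    ‖g (c * j / v) / v‖ ≤ K * V / c ^ 2 * (1 / (j : ℝ) ^ 2) := by
  have hj : (0 : ℝ) < j := by exact_mod_cast j.pos
  have hK := h.const_nonneg
  calc _ ≤ K * v / (c * j) ^ 2 := h.abs_comp_div_le (mul_pos hc hj) hv
    _ ≤ K * V / (c * j) ^ 2 := by gcongr
    _ = _ := by field_simp

theorem summable_comp_mul_div (h : IsInversionRegular g g₁ g₂ K) (hc : 0 < c) {v : ℝ}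
    (hv : 0 ≤ v) : Summable fun j : ℕ+ => g (c * j / v) / v :=
  Summable.of_norm_bounded (summable_pnat_inv_sq.mul_left _)
    fun j => h.abs_comp_mul_div_le hc j hv le_rfl

theorem continuousOn_comp_mul_div (h : IsInversionRegular g g₁ g₂ K) (hc : 0 < c) (j : ℕ+) :
    ContinuousOn (fun v => g (c * j / v) / v) (Ici 0) :=
  (h.isTrapezoidRegular (mul_pos hc (by exact_mod_cast j.pos))).continuousOn

theorem intervalIntegrable_tsum (h : IsInversionRegular g g₁ g₂ K) (hc : 0 < c) {a b : ℝ}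
    (ha : 0 ≤ a) (hab : a ≤ b) :
    IntervalIntegrable (fun v => ∑' j : ℕ+, g (c * j / v) / v) volume a b := by
  refine ContinuousOn.intervalIntegrable ?_
  rw [uIcc_of_le hab]
  exact continuousOn_tsum
    (fun j => (h.continuousOn_comp_mul_div hc j).mono fun v hv => ha.trans hv.1)
    (summable_pnat_inv_sq.mul_left (K * b / c ^ 2))
    fun j v hv => h.abs_comp_mul_div_le hc j (ha.trans hv.1) hv.2

theorem hasSum_integral_comp_mul_div (h : IsInversionRegular g g₁ g₂ K) (hc : 0 < c) {V : ℝ}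
    (hV : 0 ≤ V) : HasSum (fun j : ℕ+ => ∫ v in 0..V, g (c * j / v) / v)
      (∫ v in 0..V, ∑' j : ℕ+, g (c * j / v) / v) := by
  refine intervalIntegral.hasSum_integral_of_dominated_convergence
    (fun j _ => K * V / c ^ 2 * (1 / (j : ℝ) ^ 2)) (fun j => ?_)
    (fun j => ae_of_all _ fun v hv => ?_)
    (ae_of_all _ fun v _ => summable_pnat_inv_sq.mul_left _) intervalIntegrable_const
    (ae_of_all _ fun v hv => ?_)
  · rw [uIoc_of_le hV]
    exact ((h.continuousOn_comp_mul_div hc j).mono fun v hv =>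
      le_of_lt hv.1).aestronglyMeasurable measurableSet_Ioc
  · rw [uIoc_of_le hV] at hv
    exact h.abs_comp_mul_div_le hc j hv.1.le hv.2
  · rw [uIoc_of_le hV] at hv
    exact (h.summable_comp_mul_div hc hv.1.le).hasSum

theorem tsum_trapezoid_eq (h : IsInversionRegular g g₁ g₂ K) (hc : 0 < c) (M : ℕ) :
    ∑' j : ℕ+, (∑ m ∈ Finset.range M, g (c * j / (m + 1 : ℕ)) / (m + 1 : ℕ)
        - g (c * j / M) / M / 2 - ∫ v in (0 : ℝ)..M, g (c * j / v) / v)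
      = ∑ m ∈ Finset.range M, (∑' j : ℕ+, g (c * j / (m + 1 : ℕ)) / (m + 1 : ℕ))
        - (∑' j : ℕ+, g (c * j / M) / M) / 2
        - ∫ v in (0 : ℝ)..M, ∑' j : ℕ+, g (c * j / v) / v := by
  have hs : ∀ m : ℕ, HasSum (fun j : ℕ+ => g (c * j / m) / m) (∑' j : ℕ+, g (c * j / m) / m) :=
    fun m => (h.summable_comp_mul_div hc m.cast_nonneg).hasSum
  exact (((hasSum_sum fun m _ => hs (m + 1)).sub ((hs M).div_const 2)).sub
    (h.hasSum_integral_comp_mul_div hc M.cast_nonneg)).tsum_eq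

end IsInversionRegular

/-! ### Both evaluations for F, and the final identity. -/

/-- An even function `F` whose derivatives on `[0, ∞[` are `P n`, rapidly decreasing, and whose
Fourier transform is regular under inversion. -/
structure IsEvenRapid (F : ℝ → ℝ) (P : ℕ → ℝ → ℝ) (g₁ g₂ : ℝ → ℝ) (K : ℝ) : Prop where
  even : Function.Even F
  jet : IsRapidJet P
  zero_eq : P 0 = F
  regular : IsInversionRegular (fourierHat F) g₁ g₂ K

theorem RapidlyDecreasingOnIic.exists_isEvenRapid {F : ℝ → ℝ} (hF : RapidlyDecreasingOnIic 0 F)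
    (hEven : Function.Even F) : ∃ P g₁ g₂ K, IsEvenRapid F P g₁ g₂ K := by
  obtain ⟨P, hP, rfl⟩ := hF.exists_isRapidJet hEven
  obtain ⟨g₁, g₂, K, hg⟩ := hP.isInversionRegular
  exact ⟨P, g₁, g₂, K, hEven, hP, rfl, hg⟩

namespace IsEvenRapid

variable {F : ℝ → ℝ} {P : ℕ → ℝ → ℝ} {g₁ g₂ : ℝ → ℝ} {K y : ℝ}

theorem apply_abs (h : IsEvenRapid F P g₁ g₂ K) (x : ℝ) : F |x| = F x := by
  rcases abs_choice x with e | e <;> rw [e]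
  exact h.even x

theorem continuous (h : IsEvenRapid F P g₁ g₂ K) : Continuous F := by
  have h1 : ContinuousOn F (Ici 0) := h.zero_eq ▸ h.jet.continuousOn 0
  have h2 := h1.comp_continuous continuous_abs fun x => abs_nonneg x
  exact h2.congr h.apply_abs

theorem exists_bound (h : IsEvenRapid F P g₁ g₂ K) :
    ∃ C, 0 ≤ C ∧ ∀ x, |F x| ≤ C * (1 + x ^ 2)⁻¹ := by
  obtain ⟨C, hC0, hC⟩ := h.jet.exists_bound 0
  refine ⟨C, hC0, fun x => ?_⟩
  have := hC |x| (abs_nonneg x)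
  rwa [h.zero_eq, h.apply_abs, sq_abs] at this

theorem integrable (h : IsEvenRapid F P g₁ g₂ K) : Integrable F := by
  obtain ⟨C, -, hC⟩ := h.exists_bound
  exact (integrable_inv_one_add_sq.const_mul C).mono' h.continuous.aestronglyMeasurable
    (ae_of_all _ hC)

theorem exists_sq_bound (h : IsEvenRapid F P g₁ g₂ K) : ∃ C, 0 ≤ C ∧ ∀ x, x ^ 2 * |F x| ≤ C := by
  obtain ⟨C, hC0, hC⟩ := h.exists_bound
  refine ⟨C, hC0, fun x => ?_⟩
  have := hC x
  rw [← div_eq_mul_inv, le_div_iff₀ (by positivity)] at this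
  nlinarith [abs_nonneg (F x)]

theorem summable_prod (h : IsEvenRapid F P g₁ g₂ K) (hy : 0 < y) :
    Summable fun p : ℕ+ × ℕ+ => F ((p.1 * p.2 : ℕ) * y) := by
  obtain ⟨C, hC0, hC⟩ := h.exists_sq_bound
  refine Summable.of_norm_bounded (summable_prod_inv_sq.mul_left (C / y ^ 2)) fun p => ?_
  have h1 : (0 : ℝ) < p.1 := by exact_mod_cast p.1.pos
  have h2 : (0 : ℝ) < p.2 := by exact_mod_cast p.2.pos
  have := hC ((p.1 * p.2 : ℕ) * y)
  push_cast at this ⊢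
  rw [div_mul_div_comm, mul_one, le_div_iff₀ (by positivity), Real.norm_eq_abs]
  linarith

/-- Poisson summation at scale w = vy, divided by v. -/
theorem tsum_fourierHat_eq (h : IsEvenRapid F P g₁ g₂ K) (hy : 0 < y) {v : ℝ} (hv : 0 < v) :
    ∑' j : ℕ+, fourierHat F (2 * Real.pi / y * j / v) / v
      = y * ∑' k : ℕ+, F (k * (v * y)) + y * F 0 / 2 - (∫ u in Ioi (0 : ℝ), F u) * v⁻¹ := by
  obtain ⟨C, -, hC⟩ := h.exists_sq_bound
  have := tsum_fourierHat_div h.continuous h.even h.integrable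
    (fun x => (hC x).trans (le_max_left C K)) (fun x => (h.regular.decay x).trans (le_max_right C K))
    (mul_pos hv hy)
  have e0 : fourierHat F 0 = 2 * ∫ u in Ioi (0 : ℝ), F u := by simp [fourierHat]
  have e : ∀ j : ℕ+, 2 * Real.pi / y * j / v = 2 * Real.pi * j / (v * y) := fun j => by
    field_simp
  rw [tsum_div_const]
  simp only [e]
  rw [this, e0]
  field_simp
  ring

/-- Termwise, the substitution u = kyv gives (1/k) ∫ F over [kεy, kVy], a difference of terms of two
harmonic tails. -/
theorem integral_tsum_mul (h : IsEvenRapid F P g₁ g₂ K) (hy : 0 < y) {ε V : ℝ} (hε : 0 < ε)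
    (hV : ε ≤ V) :
    y * (∫ v in ε..V, ∑' k : ℕ+, F (k * (v * y))) = harmonicTail F (ε * y) - harmonicTail F (V * y)
    ∧ IntervalIntegrable (fun v => ∑' k : ℕ+, F (k * (v * y))) volume ε V := by
  obtain ⟨C, hC0, hC⟩ := h.exists_sq_bound
  have hcont := h.continuous
  have hb : ∀ (k : ℕ+) (v : ℝ), ε ≤ v →
      ‖F (k * (v * y))‖ ≤ C / (ε * y) ^ 2 * (1 / (k : ℝ) ^ 2) := fun k v hv => by
    have hk : (0 : ℝ) < k := by exact_mod_cast k.pos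
    have hv0 : 0 < v := hε.trans_le hv
    have := hC (k * (v * y))
    calc ‖F (k * (v * y))‖ ≤ C / (k * (v * y)) ^ 2 := by
          rw [le_div_iff₀ (by positivity), mul_comm]; exact this
      _ ≤ C / (k * (ε * y)) ^ 2 := by gcongr
      _ = _ := by field_simp
  have hs : Summable fun k : ℕ+ => C / (ε * y) ^ 2 * (1 / (k : ℝ) ^ 2) :=
    summable_pnat_inv_sq.mul_left _
  constructor
  · have h1 : HasSum (fun k : ℕ+ => ∫ v in ε..V, F (k * (v * y)))
        (∫ v in ε..V, ∑' k : ℕ+, F (k * (v * y))) := by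
      refine intervalIntegral.hasSum_integral_of_dominated_convergence
        (fun k _ => C / (ε * y) ^ 2 * (1 / (k : ℝ) ^ 2))
        (fun k => Continuous.aestronglyMeasurable (by fun_prop))
        (fun k => ae_of_all _ fun v hv => ?_) (ae_of_all _ fun v _ => hs) intervalIntegrable_const
        (ae_of_all _ fun v hv => ?_)
      · rw [uIoc_of_le hV] at hv
        exact hb k v hv.1.le
      · rw [uIoc_of_le hV] at hv
        exact (Summable.of_norm_bounded hs fun k => hb k v hv.1.le).hasSum
    have h2 := (h.jet.hasSum_harmonicTail (mul_pos hε hy)).sub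
      (h.jet.hasSum_harmonicTail (mul_pos (hε.trans_le hV) hy))
    rw [h.zero_eq] at h2
    refine (h1.mul_left y).unique (h2.congr_fun fun k => ?_)
    have hk : (0 : ℝ) < k := by exact_mod_cast k.pos
    have hi : ∀ a, IntegrableOn F (Ioi a) := fun a => h.integrable.integrableOn
    rw [← mul_sub, intervalIntegral.integral_Ioi_sub_Ioi (hi _) (by gcongr)]
    have e : ∀ v, F (k * (v * y)) = F (k * y * v) := fun v => by ring_nf
    simp only [e]
    rw [intervalIntegral.integral_comp_mul_left _ (by positivity), smul_eq_mul]
    rw [show (k : ℝ) * y * ε = k * (ε * y) by ring, show (k : ℝ) * y * V = k * (V * y) by ring]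
    field_simp
  · refine ContinuousOn.intervalIntegrable ?_
    rw [uIcc_of_le hV]
    exact continuousOn_tsum (fun k => Continuous.continuousOn (by fun_prop)) hs
      fun k v hv => hb k v hv.1

/-- The Poisson formula is integrated over [ε, V] and ε → 0. The tail at εy and the integral of I/v
both diverge logarithmically, and their divergences cancel; the piece over [0, ε] vanishes since the
integrand is continuous up to 0. -/
theorem integral_tsum_fourierHat (h : IsEvenRapid F P g₁ g₂ K) (hy : 0 < y) {V : ℝ} (hV : 0 < V) :
    ∫ v in 0..V, ∑' j : ℕ+, fourierHat F (2 * Real.pi / y * j / v) / v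
      = (∫ u in Ioi (0 : ℝ), F u * (Real.log (u / y) + Real.eulerMascheroniConstant))
        - harmonicTail F (V * y) + y * F 0 / 2 * V - (∫ u in Ioi (0 : ℝ), F u) * Real.log V := by
  have hc : 0 < 2 * Real.pi / y := div_pos Real.two_pi_pos hy
  obtain ⟨T, hT⟩ : ∃ T : ℝ → ℝ,
    T = fun v => ∑' j : ℕ+, fourierHat F (2 * Real.pi / y * j / v) / v := ⟨_, rfl⟩
  have hTi : ∀ a b : ℝ, 0 ≤ a → a ≤ b → IntervalIntegrable T volume a b := fun a b ha hab =>
    hT ▸ h.regular.intervalIntegrable_tsum hc ha hab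
  have hlog := h.jet.tendsto_harmonicTail_add_log hy
  rw [h.zero_eq] at hlog
  have h0 : Tendsto (fun ε : ℝ => ∫ v in 0..ε, T v) (𝓝[>] 0) (𝓝 0) := by
    have hi : IntegrableOn T (uIcc 0 V) := by
      rw [uIcc_of_le hV.le, integrableOn_Icc_iff_integrableOn_Ioc,
        ← intervalIntegrable_iff_integrableOn_Ioc_of_le hV.le]
      exact hTi 0 V le_rfl hV.le
    have := intervalIntegral.continuousOn_primitive_interval hi 0 left_mem_uIcc
    rw [ContinuousWithinAt, intervalIntegral.integral_same, uIcc_of_le hV.le] at this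
    refine this.mono_left ?_
    rw [← nhdsWithin_Ioc_eq_nhdsGT hV]
    exact nhdsWithin_mono _ Ioc_subset_Icc_self
  have hid : Tendsto (fun ε : ℝ => y * F 0 / 2 * (V - ε)) (𝓝[>] 0) (𝓝 (y * F 0 / 2 * (V - 0))) :=
    (tendsto_const_nhds.sub (tendsto_id.mono_left nhdsWithin_le_nhds)).const_mul _
  have hlim := ((h0.add hlog).add hid).sub_const
    (harmonicTail F (V * y) + (∫ u in Ioi (0 : ℝ), F u) * Real.log V)
  have hev : ∀ᶠ ε : ℝ in 𝓝[>] 0, (∫ v in 0..ε, T v) + (harmonicTail F (ε * y)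
      + (∫ u in Ioi (0 : ℝ), F u) * Real.log ε) + y * F 0 / 2 * (V - ε)
      - (harmonicTail F (V * y) + (∫ u in Ioi (0 : ℝ), F u) * Real.log V) = ∫ v in 0..V, T v := by
    filter_upwards [Ioo_mem_nhdsGT hV] with ε ⟨hε, hεV⟩
    obtain ⟨e1, i1⟩ := h.integral_tsum_mul hy hε hεV.le
    have i2 : IntervalIntegrable (fun v : ℝ => v⁻¹) volume ε V :=
      intervalIntegral.intervalIntegrable_inv (fun v hv => by
        rw [uIcc_of_le hεV.le] at hv
        exact (hε.trans_le hv.1).ne') continuousOn_id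
    have e2 : ∫ v in ε..V, T v = ∫ v in ε..V, (y * ∑' k : ℕ+, F (k * (v * y)) + y * F 0 / 2
        - (∫ u in Ioi (0 : ℝ), F u) * v⁻¹) := by
      refine intervalIntegral.integral_congr fun v hv => ?_
      rw [uIcc_of_le hεV.le] at hv
      rw [hT]
      exact h.tsum_fourierHat_eq hy (hε.trans_le hv.1)
    rw [intervalIntegral.integral_sub ((i1.const_mul y).add intervalIntegrable_const)
      (i2.const_mul _), intervalIntegral.integral_add (i1.const_mul y) intervalIntegrable_const,
      intervalIntegral.integral_const_mul, e1, intervalIntegral.integral_const,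
      intervalIntegral.integral_const_mul, integral_inv_of_pos hε hV,
      Real.log_div hV.ne' hε.ne', smul_eq_mul] at e2
    rw [← intervalIntegral.integral_add_adjacent_intervals (hTi 0 ε le_rfl hε.le)
      (hTi ε V hε.le hεV.le), e2]
    ring
  have := tendsto_nhds_unique (hlim.congr' hev) tendsto_const_nhds
  rw [hT] at this
  rw [← this]
  ring

/-- Comparison of the two evaluations. The terms MyF(0)/2 from the sum and the integral cancel,
−I(H_M − ln M) tends to −Iγ, and the halved endpoint contributes −yF(0)/4 in the limit. -/
theorem two_mul_tsum_eq (h : IsEvenRapid F P g₁ g₂ K) (hy : 0 < y) :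
    2 * ∑' n : ℕ+, ((n : ℕ).divisors.card : ℝ) *
        IsInversionRegular.cosInvIntegral (fourierHat F) g₁ g₂ (2 * Real.pi * n) (2 * Real.pi / y)
      = y * ∑' n : ℕ+, ((n : ℕ).divisors.card : ℝ) * F (n * y)
        - (∫ u in Ioi (0 : ℝ), F u) * Real.eulerMascheroniConstant - y * F 0 / 4
        - ∫ u in Ioi (0 : ℝ), F u * (Real.log (u / y) + Real.eulerMascheroniConstant) := by
  have hc : 0 < 2 * Real.pi / y := div_pos Real.two_pi_pos hy
  obtain ⟨A, hA⟩ : ∃ A : ℕ → ℝ, A = fun m : ℕ => ∑' k : ℕ+, F (k * (m * y)) := ⟨_, rfl⟩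
  have hsum : HasSum (fun m : ℕ => A (m + 1))
      (∑' n : ℕ+, ((n : ℕ).divisors.card : ℝ) * F (n * y)) := by
    rw [(hasSum_card_divisors_mul (f := fun n => F (n * y)) (h.summable_prod hy)).tsum_eq]
    have h1 := (h.summable_prod hy).hasSum.prod_fiberwise
      fun m => ((h.summable_prod hy).prod_factor m).hasSum
    refine (Equiv.pnatEquivNat.symm.hasSum_iff.2 h1).congr_fun fun m => ?_
    rw [hA]
    refine tsum_congr fun k => ?_
    simp
    ring_nf
  have hA0 : Tendsto A atTop (𝓝 0) :=
    (tendsto_add_atTop_iff_nat 1).1 hsum.summable.tendsto_atTop_zero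
  have hinv : Tendsto (fun M : ℕ => (M : ℝ)⁻¹) atTop (𝓝 0) := tendsto_inv_atTop_nhds_zero_nat
  have hH : Tendsto (fun M : ℕ => harmonicTail F (M * y)) atTop (𝓝 0) := by
    have := h.jet.tendsto_harmonicTail_atTop
    rw [h.zero_eq] at this
    exact this.comp (tendsto_natCast_atTop_atTop.atTop_mul_const hy)
  have hlim := ((((((hsum.tendsto_sum_nat.const_mul y).sub
    (Real.tendsto_harmonic_sub_log.const_mul (∫ u in Ioi (0 : ℝ), F u))).sub
    (hA0.const_mul (y / 2))).sub_const (y * F 0 / 4)).add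
    (hinv.const_mul ((∫ u in Ioi (0 : ℝ), F u) / 2))).sub_const
    (∫ u in Ioi (0 : ℝ), F u * (Real.log (u / y) + Real.eulerMascheroniConstant))).add hH
  have hval : ∀ M : ℕ, 0 < M → ∑' j : ℕ+, fourierHat F (2 * Real.pi / y * j / M) / M
      = y * A M + y * F 0 / 2 - (∫ u in Ioi (0 : ℝ), F u) * (M : ℝ)⁻¹ := fun M hM => by
    rw [hA]
    exact h.tsum_fourierHat_eq hy (by exact_mod_cast hM)
  refine (tendsto_nhds_unique (h.regular.tendsto_tsum_trapezoid hc) (hlim.congr' ?_)).trans ?_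
  · filter_upwards [eventually_gt_atTop 0] with M hM
    rw [h.regular.tsum_trapezoid_eq hc, h.integral_tsum_fourierHat hy (by exact_mod_cast hM),
      hval M hM, Finset.sum_congr rfl fun m _ => hval (m + 1) m.succ_pos, Finset.sum_sub_distrib,
      Finset.sum_add_distrib, ← Finset.mul_sum, ← Finset.mul_sum, Finset.sum_const,
      Finset.card_range, nsmul_eq_mul]
    have : (harmonic M : ℝ) = ∑ m ∈ Finset.range M, ((m + 1 : ℕ) : ℝ)⁻¹ := by
      rw [harmonic, Rat.cast_sum]
      push_cast
      rfl
    rw [this]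
    ring
  · ring

end IsEvenRapid

theorem mainTheorem5 (F : ℝ → ℝ) (hF : RapidlyDecreasingOnIic 0 F) (hEven : Function.Even F)
    (y : ℝ) (hy : 0 < y) :
    Summable (fun n : ℕ+ => ((n : ℕ).divisors.card : ℝ) * F (n * y)) ∧
    IntegrableOn
      (fun u : ℝ => F u * (Real.log (u / y) + 2 * Real.eulerMascheroniConstant)) (Ioi 0) ∧
    ∃ S : ℕ+ → ℝ,
      (∀ n : ℕ+, HasImproperIntegral
        (fun x : ℝ => Real.cos (4 * Real.pi ^ 2 * n / (x * y)) * fourierHat F x / x) (S n)) ∧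
      Summable (fun n : ℕ+ => ((n : ℕ).divisors.card : ℝ) * S n) ∧
      ∑' n : ℕ+, ((n : ℕ).divisors.card : ℝ) * F (n * y) =
        1 / y * (∫ u in Ioi (0 : ℝ),
            F u * (Real.log (u / y) + 2 * Real.eulerMascheroniConstant))
          + F 0 / 4
          + 2 / y * ∑' n : ℕ+, ((n : ℕ).divisors.card : ℝ) * S n := by
  obtain ⟨P, g₁, g₂, K, h⟩ := hF.exists_isEvenRapid hEven
  have hc : 0 < 2 * Real.pi / y := div_pos Real.two_pi_pos hy
  have hlog : ∀ c, IntegrableOn (fun u => F u * (Real.log (u / y) + c)) (Ioi 0) := fun c => by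
    have := h.jet.integrableOn_mul_log_div_add hy c
    rwa [h.zero_eq] at this
  obtain ⟨S, hS⟩ : ∃ S : ℕ → ℝ, S = fun n : ℕ =>
    IsInversionRegular.cosInvIntegral (fourierHat F) g₁ g₂ (2 * Real.pi * n) (2 * Real.pi / y) := ⟨_, rfl⟩
  have hsum : Summable fun p : ℕ+ × ℕ+ => S (p.1 * p.2) :=
    hS ▸ h.regular.summable_cosInvIntegral hc
  refine ⟨(hasSum_card_divisors_mul (f := fun n => F (n * y)) (h.summable_prod hy)).summable,
    hlog _, fun n => S n, fun n => ?_, (hasSum_card_divisors_mul hsum).summable, ?_⟩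
  · have hn : (0 : ℝ) < n := by exact_mod_cast n.pos
    have := h.regular.hasImproperIntegral (a := 2 * Real.pi * n) (by positivity) hc
    have e : ∀ x, 2 * Real.pi * n * (2 * Real.pi / y) / x = 4 * Real.pi ^ 2 * n / (x * y) :=
      fun x => by field_simp; ring
    simp only [e] at this
    rwa [hS]
  · have key := h.two_mul_tsum_eq hy
    have hSn : ∀ n : ℕ+, S n = IsInversionRegular.cosInvIntegral (fourierHat F) g₁ g₂
      (2 * Real.pi * n) (2 * Real.pi / y) := fun n => by rw [hS]
    simp only [← hSn] at key
    have e : ∫ u in Ioi (0 : ℝ), F u * (Real.log (u / y) + 2 * Real.eulerMascheroniConstant)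
        = (∫ u in Ioi (0 : ℝ), F u * (Real.log (u / y) + Real.eulerMascheroniConstant))
          + (∫ u in Ioi (0 : ℝ), F u) * Real.eulerMascheroniConstant := by
      rw [← integral_mul_const, ← integral_add (hlog _) (h.integrable.integrableOn.mul_const _)]
      congr 1
      ext u
      ring
    rw [e]
    field_simp
    linarith
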